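/- Let $A\in\mathbf R^{m\times n}$, $B\in\mathbf R^{\nu\times n}$ and $\sigma>0$. Let $\mathcal X\subset\mathbf R^n$ be an ellitope, i.e. $$\mathcal X=\{x\in\mathbf R^n:\ \exists y\in\mathbf R^{\bar n},\ t\in\mathcal T:\ x=Py,\ y^TS_ky\le t_k,\ 1\le k\le K\},$$ where $P\in\mathbf R^{n\times\bar n}$, the $S_k\succeq0$ are symmetric $\bar n\times\bar n$ matrices with $\sum_kS_k\succ0$, and $\mathcal T\subset\mathbf R^K_+$ is a convex compact set that contains a vector with all entries positive and is monotone: $0\le\tau\le t\in\mathcal T$ implies $\tau\in\mathcal T$. Assume $BP\ne0$. For a Borel estimate $\widehat w:\mathbf R^m\to\mathbf R^\nu$ put $$\mathrm{Risk}[\widehat w|\mathcal X]=\sup_{x\in\mathcal X}\Big(\mathbf E_{\xi\sim\mathcal N(0,I_m)}\|\widehat w(Ax+\sigma\xi)-Bx\|_2^2\Big)^{1/2}\in[0,\infty],\qquad \mathrm{Risk}_{\rm opt}[\mathcal X]=\inf_{\widehat w\ \text{Borel}}\mathrm{Risk}[\widehat w|\mathcal X].$$ Let $\phi_{\mathcal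 T}(\lambda)=\max_{t\in\mathcal T}\lambda^Tt$, $\bar A=AP$, $\bar B=BP$, and consider the optimization problem over $H\in\mathbf R^{m\times\nu}$ and $\lambda\in\mathbf R^K$ $$\mathrm{Opt}=\min_{H,\lambda}\Big\{\sigma^2\mathrm{Tr}(H^TH)+\phi_{\mathcal T}(\lambda):\ (\bar B-H^T\bar A)^T(\bar B-H^T\bar A)\preceq\sum_k\lambda_kS_k,\ \lambda\ge0\Big\}.$$ Let $\mathcal Q=\{Q\in\mathbf R^{\bar n\times\bar n}:Q=Q^T\succeq0,\ \exists t\in\mathcal T:\ \mathrm{Tr}(QS_k)\le t_k,\ 1\le k\le K\}$ and $M_*^2=\max_{Q\in\mathcal Q}\mathrm{Tr}(\bar BQ\bar B^T)$. Then the problem defining $\mathrm{Opt}$ is convex and solvable, the maximum defining $M_*^2$ is attained, $0<\mathrm{Risk}_{\rm opt}[\mathcal X]<\infty$, and for every optimal solution $(H_*,\lambda_*)$ the linear estimate $\widehat w_{H_*}(\omega)=H_*^T\omega$ satisfies $$\mathrm{Risk}[\widehat w_{H_*}|\mathcal X]\le\sqrt{\mathrm{Opt}}\le\sqrt{6\ln\left(\frac{8M_*^2K}{\mathrm{Risk}_{\rm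 opt}^2[\mathcal X]}\right)}\ \mathrm{Risk}_{\rm opt}[\mathcal X].$$ -/

import Mathlib

open MeasureTheory ProbabilityTheory Matrix
open scoped ENNReal

noncomputable section

/-- The data `[P, {S_k, k ≤ K}, T]` of an ellitopic representation of a subset of `ℝⁿ`
(with `nbar` the dimension of the lifted space). -/
structure Ellitope (n nbar K : ℕ) where
  P : Matrix (Fin n) (Fin nbar) ℝ
  S : Fin K → Matrix (Fin nbar) (Fin nbar) ℝ
  T : Set (Fin K → ℝ)
  S_posSemidef : ∀ k, (S k).PosSemidef
  sum_S_posDef : (∑ k, S k).PosDef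
  T_nonneg : ∀ t ∈ T, ∀ k, 0 ≤ t k
  T_convex : Convex ℝ T
  T_compact : IsCompact T
  T_meets_interior : ∃ t ∈ T, ∀ k, 0 < t k
  T_monotone : ∀ t ∈ T, ∀ τ : Fin K → ℝ, (∀ k, 0 ≤ τ k) → (∀ k, τ k ≤ t k) → τ ∈ T

namespace Ellitope

variable {n nbar K : ℕ}

/-- The signal set
`X = {x : ∃ y, ∃ t ∈ T, x = P y, yᵀ S_k y ≤ t_k for all k}`. -/
def X (E : Ellitope n nbar K) : Set (EuclideanSpace ℝ (Fin n)) :=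
  {x | ∃ y : EuclideanSpace ℝ (Fin nbar), ∃ t ∈ E.T,
    x = E.P.toEuclideanLin y ∧ ∀ k, y.ofLp ⬝ᵥ (E.S k *ᵥ y.ofLp) ≤ t k}

/-- The support function `φ_T(λ) = max_{t ∈ T} λᵀ t`. -/
def supportFun (E : Ellitope n nbar K) (lam : Fin K → ℝ) : ℝ :=
  sSup ((fun t => lam ⬝ᵥ t) '' E.T)

/-- The set `{Q ⪰ 0 : ∃ t ∈ T, Tr(Q S_k) ≤ t_k for all k}`. -/
def Qset (E : Ellitope n nbar K) : Set (Matrix (Fin nbar) (Fin nbar) ℝ) :=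
  {Q | Q.PosSemidef ∧ ∃ t ∈ E.T, ∀ k, (Q * E.S k).trace ≤ t k}

end Ellitope

variable {m n nbar K ν : ℕ}

/-- The risk over a signal set `X` of an estimate `w` of `B x` from `ω = A x + σ ξ`, where
`ξ ∼ N(0, I_m)`:  `sup_{x ∈ X} (E ‖w(A x + σ ξ) - B x‖₂²)^{1/2}`, with values in `[0, ∞]`. -/
def risk (A : Matrix (Fin m) (Fin n) ℝ) (B : Matrix (Fin ν) (Fin n) ℝ) (σ : ℝ)
    (X : Set (EuclideanSpace ℝ (Fin n)))
    (w : EuclideanSpace ℝ (Fin m) → EuclideanSpace ℝ (Fin ν)) : ℝ≥0∞ :=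
  ⨆ x ∈ X, (∫⁻ ξ, ‖w (A.toEuclideanLin x + σ • ξ) - B.toEuclideanLin x‖ₑ ^ 2
    ∂(stdGaussian (EuclideanSpace ℝ (Fin m)))) ^ (1 / 2 : ℝ)

/-- The minimax risk: the infimum of the risk over all Borel estimates. -/
def riskOpt (A : Matrix (Fin m) (Fin n) ℝ) (B : Matrix (Fin ν) (Fin n) ℝ) (σ : ℝ)
    (X : Set (EuclideanSpace ℝ (Fin n))) : ℝ≥0∞ :=
  ⨅ (w : EuclideanSpace ℝ (Fin m) → EuclideanSpace ℝ (Fin ν)) (_ : Measurable w),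
    risk A B σ X w

/-- The linear estimate `ω ↦ Hᵀ ω`. -/
def linearEstimate (H : Matrix (Fin m) (Fin ν) ℝ) :
    EuclideanSpace ℝ (Fin m) → EuclideanSpace ℝ (Fin ν) :=
  fun ω => Hᵀ.toEuclideanLin ω

/-- Feasible set of the design program: the pairs `(H, λ)` with `λ ≥ 0` and
`(BP - Hᵀ AP)ᵀ (BP - Hᵀ AP) ⪯ ∑ λ_k S_k`. -/
def programFeasible (E : Ellitope n nbar K) (A : Matrix (Fin m) (Fin n) ℝ)
    (B : Matrix (Fin ν) (Fin n) ℝ) : Set (Matrix (Fin m) (Fin ν) ℝ × (Fin K → ℝ)) :=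
  {p | (∀ k, 0 ≤ p.2 k) ∧
    ((∑ k, p.2 k • E.S k) -
      (B * E.P - p.1ᵀ * (A * E.P))ᵀ * (B * E.P - p.1ᵀ * (A * E.P))).PosSemidef}

/-- Objective of the design program: `σ² Tr(Hᵀ H) + φ_T(λ)`. -/
def programObjective (E : Ellitope n nbar K) (σ : ℝ)
    (p : Matrix (Fin m) (Fin ν) ℝ × (Fin K → ℝ)) : ℝ :=
  σ ^ 2 * (p.1ᵀ * p.1).trace + E.supportFun p.2

/-- `(H, λ)` is an optimal solution of the design program. -/
def IsOptimalSolution (E : Ellitope n nbar K) (A : Matrix (Fin m) (Fin n) ℝ)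
    (B : Matrix (Fin ν) (Fin n) ℝ) (σ : ℝ)
    (p : Matrix (Fin m) (Fin ν) ℝ × (Fin K → ℝ)) : Prop :=
  p ∈ programFeasible E A B ∧ IsMinOn (programObjective E σ) (programFeasible E A B) p

/-- The optimal value `Opt` of the design program. -/
def programOpt (E : Ellitope n nbar K) (A : Matrix (Fin m) (Fin n) ℝ)
    (B : Matrix (Fin ν) (Fin n) ℝ) (σ : ℝ) : ℝ :=
  sInf (programObjective E σ '' programFeasible E A B)

/-- The values `Tr((BP) Q (BP)ᵀ)` for `Q` in `E.Qset`. -/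
def traceValues (E : Ellitope n nbar K) (B : Matrix (Fin ν) (Fin n) ℝ) : Set ℝ :=
  (fun Q => ((B * E.P) * Q * (B * E.P)ᵀ).trace) '' E.Qset

/-- The quantity `M_* = (max_{Q} Tr((BP) Q (BP)ᵀ))^{1/2}`. -/
def Mstar (E : Ellitope n nbar K) (B : Matrix (Fin ν) (Fin n) ℝ) : ℝ :=
  √(sSup (traceValues E B))

end

/-! The upper bound is the bias-variance identity: the matrix inequality and the definition of
`supportFun` bound the squared bias over the ellitope, and the noise contributes `σ² Tr(HᵀH)`.

For the lower bound, Lagrange duality (`exists_dual_matrix`) turns `Opt`, up to ε, into a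
covariance: some `Q` in `Qset` satisfies `σ² Tr(HᵀH) + Tr(GᵀGQ) ≥ Opt - ε` for every `H`, where `G =
BP - HᵀAP`. Give `y` the prior `N(0, αQ)` with a small `α`. For jointly Gaussian data a linear
estimate is Bayes optimal, so every estimate has Bayes risk at least `α(Opt - ε)`
(`exists_linear_bayes_lower_bound`).

This prior is not supported on the signal set. After truncation to the ball of radius `M_*`, which
costs nothing on the set, the error off the set is dominated by exponentials of quadratic forms, one
for each constraint that `y` may violate (`lintegral_truncated_le`). Their Gaussian means are at
most 2 (`lintegral_exp_quadForm_le`), whence `α Opt ≤ Risk² + 4 M_*² K exp(-1/(4α))`. Taking `α =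
1/(4L)` with `L = ln(8 M_*² K / Risk_opt²)` makes the last term `Risk_opt²/2` and gives `Opt ≤ 6 L
Risk_opt²`. -/

namespace Ellitope

/-! ### Support function of the monotone set `T` -/

variable {n nbar K : ℕ}

lemma bddAbove_dotProduct_image (E : Ellitope n nbar K) (lam : Fin K → ℝ) :
    BddAbove ((fun t => lam ⬝ᵥ t) '' E.T) :=
  (E.T_compact.image (by fun_prop)).bddAbove

lemma dotProduct_le_supportFun (E : Ellitope n nbar K) (lam : Fin K → ℝ) {t : Fin K → ℝ}
    (ht : t ∈ E.T) : lam ⬝ᵥ t ≤ E.supportFun lam :=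
  le_csSup (E.bddAbove_dotProduct_image lam) ⟨t, ht, rfl⟩

lemma T_nonempty (E : Ellitope n nbar K) : E.T.Nonempty :=
  let ⟨t, ht, _⟩ := E.T_meets_interior
  ⟨t, ht⟩

lemma supportFun_le_iff (E : Ellitope n nbar K) {lam : Fin K → ℝ} {c : ℝ} :
    E.supportFun lam ≤ c ↔ ∀ t ∈ E.T, lam ⬝ᵥ t ≤ c := by
  constructor
  · exact fun h t ht => (E.dotProduct_le_supportFun lam ht).trans h
  · intro h
    refine csSup_le (E.T_nonempty.image _) ?_
    rintro _ ⟨t, ht, rfl⟩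
    exact h t ht

lemma supportFun_smul (E : Ellitope n nbar K) (lam : Fin K → ℝ) {c : ℝ} (hc : 0 ≤ c) :
    E.supportFun (c • lam) ≤ c * E.supportFun lam := by
  rw [supportFun_le_iff]
  intro t ht
  rw [smul_dotProduct, smul_eq_mul]
  exact mul_le_mul_of_nonneg_left (E.dotProduct_le_supportFun lam ht) hc

lemma supportFun_zero (E : Ellitope n nbar K) : E.supportFun 0 = 0 := by
  apply le_antisymm
  · rw [supportFun_le_iff]; simp
  · obtain ⟨t, ht⟩ := E.T_nonempty
    simpa using E.dotProduct_le_supportFun 0 ht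

lemma convexOn_supportFun (E : Ellitope n nbar K) : ConvexOn ℝ Set.univ E.supportFun := by
  refine ⟨convex_univ, fun x _ y _ a b ha hb _ => ?_⟩
  rw [supportFun_le_iff]
  intro t ht
  rw [add_dotProduct, smul_dotProduct, smul_dotProduct]
  simp only [smul_eq_mul]
  gcongr <;> exact E.dotProduct_le_supportFun _ ht

/-- A nonnegative vector whose pairing with every nonnegative `lam` is dominated by the support
function of the monotone set `T` belongs to `T`. -/
lemma mem_T_of_forall_dotProduct_le (E : Ellitope n nbar K) {q : Fin K → ℝ} (hq : ∀ k, 0 ≤ q k)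
    (h : ∀ lam : Fin K → ℝ, (∀ k, 0 ≤ lam k) → lam ⬝ᵥ q ≤ E.supportFun lam) : q ∈ E.T := by
  by_contra hqT
  obtain ⟨f, u, hfu, huf⟩ :=
    geometric_hahn_banach_closed_point E.T_convex E.T_compact.isClosed hqT
  set g : Fin K → ℝ := fun k => f (Pi.single k 1) with hg
  have hf : ∀ x, f x = g ⬝ᵥ x := by
    intro x
    conv_lhs => rw [← Finset.univ_sum_single x]
    rw [map_sum]
    refine Finset.sum_congr rfl fun k _ => ?_
    have : (Pi.single k (x k) : Fin K → ℝ) = x k • Pi.single k 1 := by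
      rw [← Pi.single_smul]; simp
    rw [this, map_smul, smul_eq_mul, mul_comm]
  -- The separating functional may have negative coefficients. Monotonicity of `T` allows the
  -- matching coordinates of `t` to be zeroed, so the positive part of `g` separates as well.
  have h1 : E.supportFun (fun k => max (g k) 0) ≤ u := by
    rw [supportFun_le_iff]
    intro t ht
    have ht' : (fun k => if 0 ≤ g k then t k else 0) ∈ E.T := by
      refine E.T_monotone t ht _ (fun k => ?_) (fun k => ?_) <;> split_ifs
      · exact E.T_nonneg t ht k
      · exact le_rfl
      · exact le_rfl
      · exact E.T_nonneg t ht k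
    refine le_trans (le_of_eq ?_) (hfu _ ht').le
    rw [hf]
    refine Finset.sum_congr rfl fun k _ => ?_
    beta_reduce
    split_ifs with hk
    · rw [max_eq_left hk]
    · rw [max_eq_right (not_le.1 hk).le]; simp
  have h2 := h (fun k => max (g k) 0) (fun k => le_max_right _ _)
  have h3 : g ⬝ᵥ q ≤ (fun k => max (g k) 0) ⬝ᵥ q :=
    Finset.sum_le_sum fun k _ => mul_le_mul_of_nonneg_right (le_max_left _ _) (hq k)
  rw [hf] at huf
  linarith

end Ellitope

/-! ### Traces and quadratic forms -/

section MatrixLemmas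

variable {ι κ : Type*} [Fintype ι] [Fintype κ]

lemma dotProduct_transpose_mul_self_mulVec (G : Matrix κ ι ℝ) (x : ι → ℝ) :
    x ⬝ᵥ ((Gᵀ * G) *ᵥ x) = (G *ᵥ x) ⬝ᵥ (G *ᵥ x) := by
  rw [← mulVec_mulVec, dotProduct_mulVec, vecMul_transpose]

lemma trace_mul_vecMulVec_self (M : Matrix ι ι ℝ) (x : ι → ℝ) :
    (M * vecMulVec x x).trace = x ⬝ᵥ (M *ᵥ x) := by
  rw [mul_vecMulVec, trace_vecMulVec, dotProduct_comm]

lemma trace_transpose_mul_self_eq_sum (H : Matrix ι κ ℝ) :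
    (Hᵀ * H).trace = ∑ j, ∑ i, H i j ^ 2 := by
  simp [trace, mul_apply, sq]

lemma sq_le_trace_transpose_mul_self (H : Matrix ι κ ℝ) (i : ι) (j : κ) :
    H i j ^ 2 ≤ (Hᵀ * H).trace := by
  rw [trace_transpose_mul_self_eq_sum]
  refine le_trans ?_ (Finset.single_le_sum (f := fun j => ∑ i, H i j ^ 2)
    (fun j _ => Finset.sum_nonneg fun i _ => sq_nonneg _) (Finset.mem_univ j))
  exact Finset.single_le_sum (f := fun i => H i j ^ 2) (fun i _ => sq_nonneg _) (Finset.mem_univ i)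

lemma trace_transpose_mul_self_nonneg (H : Matrix ι κ ℝ) : 0 ≤ (Hᵀ * H).trace := by
  rw [trace_transpose_mul_self_eq_sum]; positivity

lemma convexOn_trace_transpose_mul_self :
    ConvexOn ℝ Set.univ (fun H : Matrix ι κ ℝ => (Hᵀ * H).trace) := by
  refine ⟨convex_univ, fun x _ y _ a b ha hb hab => ?_⟩
  simp only [trace_transpose_mul_self_eq_sum, smul_eq_mul, Finset.mul_sum,
    ← Finset.sum_add_distrib, Matrix.add_apply, Matrix.smul_apply]
  refine Finset.sum_le_sum fun j _ => Finset.sum_le_sum fun i _ => ?_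
  have hb' : b = 1 - a := by linarith
  subst hb'
  nlinarith [mul_nonneg (mul_nonneg ha hb) (sq_nonneg (x i j - y i j))]

open scoped MatrixOrder in
lemma Matrix.PosSemidef.exists_eq_transpose_mul_self [DecidableEq ι] {S : Matrix ι ι ℝ}
    (hS : S.PosSemidef) : ∃ V : Matrix ι ι ℝ, S = Vᵀ * V :=
  CStarAlgebra.nonneg_iff_eq_star_mul_self.mp hS.nonneg

/-- The trace of the product of two positive semidefinite matrices is nonnegative. -/
lemma Matrix.PosSemidef.trace_mul_nonneg [DecidableEq ι] {Q S : Matrix ι ι ℝ}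
    (hQ : Q.PosSemidef) (hS : S.PosSemidef) : 0 ≤ (Q * S).trace := by
  obtain ⟨V, rfl⟩ := hS.exists_eq_transpose_mul_self
  rw [← Matrix.mul_assoc, trace_mul_comm, ← Matrix.mul_assoc]
  exact (hQ.mul_mul_conjTranspose_same V).trace_nonneg

lemma posSemidef_iff_real {M : Matrix ι ι ℝ} :
    M.PosSemidef ↔ M.IsHermitian ∧ ∀ x, 0 ≤ x ⬝ᵥ (M *ᵥ x) := by
  rw [posSemidef_iff_dotProduct_mulVec]; simp

end MatrixLemmas

/-! ### Convexity and closedness of the perturbed design program -/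

section Program

variable {m n nbar K ν : ℕ}

/-- The matrix `BP - Hᵀ AP` of the bias of the linear estimate `ω ↦ Hᵀ ω`. -/
abbrev biasMatrix (E : Ellitope n nbar K) (A : Matrix (Fin m) (Fin n) ℝ)
    (B : Matrix (Fin ν) (Fin n) ℝ) (H : Matrix (Fin m) (Fin ν) ℝ) :
    Matrix (Fin ν) (Fin nbar) ℝ :=
  B * E.P - Hᵀ * (A * E.P)

/-- The epigraph of the value function of the design program whose matrix inequality is
perturbed to `(BP - Hᵀ AP)ᵀ (BP - Hᵀ AP) ⪯ ∑ λ_k S_k + D`. -/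
def perturbedEpigraph (E : Ellitope n nbar K) (A : Matrix (Fin m) (Fin n) ℝ)
    (B : Matrix (Fin ν) (Fin n) ℝ) (σ : ℝ) : Set (ℝ × Matrix (Fin nbar) (Fin nbar) ℝ) :=
  {z | ∃ p : Matrix (Fin m) (Fin ν) ℝ × (Fin K → ℝ), (∀ k, 0 ≤ p.2 k) ∧
    (∀ t ∈ E.T, σ ^ 2 * (p.1ᵀ * p.1).trace + p.2 ⬝ᵥ t ≤ z.1) ∧
    ∀ x, (biasMatrix E A B p.1 *ᵥ x) ⬝ᵥ (biasMatrix E A B p.1 *ᵥ x) ≤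
      x ⬝ᵥ ((∑ k, p.2 k • E.S k) *ᵥ x) + x ⬝ᵥ (z.2 *ᵥ x)}

variable (E : Ellitope n nbar K) (A : Matrix (Fin m) (Fin n) ℝ)
    (B : Matrix (Fin ν) (Fin n) ℝ) (σ : ℝ)

lemma mem_programFeasible_iff {p : Matrix (Fin m) (Fin ν) ℝ × (Fin K → ℝ)} :
    p ∈ programFeasible E A B ↔ (∀ k, 0 ≤ p.2 k) ∧
      ∀ x, (biasMatrix E A B p.1 *ᵥ x) ⬝ᵥ (biasMatrix E A B p.1 *ᵥ x) ≤
        x ⬝ᵥ ((∑ k, p.2 k • E.S k) *ᵥ x) := by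
  unfold programFeasible
  rw [Set.mem_ofPred_eq, posSemidef_iff_real]
  have hherm : ((∑ k, p.2 k • E.S k) -
      (B * E.P - p.1ᵀ * (A * E.P))ᵀ * (B * E.P - p.1ᵀ * (A * E.P))).IsHermitian := by
    refine IsHermitian.sub ?_ (isHermitian_conjTranspose_mul_self _)
    unfold IsHermitian
    rw [conjTranspose_sum]
    refine Finset.sum_congr rfl fun k _ => ?_
    rw [conjTranspose_smul, (E.S_posSemidef k).isHermitian.eq]; simp
  simp only [hherm, true_and, sub_mulVec, dotProduct_sub, sub_nonneg,
    dotProduct_transpose_mul_self_mulVec]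

/-- One inequality per `t`, each affine in `λ`, passes to limits and convex combinations without any
regularity of `supportFun`. -/
lemma programObjective_le_iff {p : Matrix (Fin m) (Fin ν) ℝ × (Fin K → ℝ)} {s : ℝ} :
    programObjective E σ p ≤ s ↔
      ∀ t ∈ E.T, σ ^ 2 * (p.1ᵀ * p.1).trace + p.2 ⬝ᵥ t ≤ s := by
  unfold programObjective
  rw [← le_sub_iff_add_le', E.supportFun_le_iff]
  simp only [le_sub_iff_add_le']

lemma mem_perturbedEpigraph_zero_iff {s : ℝ} :
    (s, 0) ∈ perturbedEpigraph E A B σ ↔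
      ∃ p ∈ programFeasible E A B, programObjective E σ p ≤ s := by
  simp only [perturbedEpigraph, Set.mem_ofPred_eq, mem_programFeasible_iff,
    programObjective_le_iff, zero_mulVec, dotProduct_zero, add_zero]
  constructor
  · rintro ⟨p, h1, h2, h3⟩; exact ⟨p, ⟨h1, h3⟩, h2⟩
  · rintro ⟨p, ⟨h1, h3⟩, h2⟩; exact ⟨p, h1, h2, h3⟩

lemma biasMatrix_convexCombination (H H' : Matrix (Fin m) (Fin ν) ℝ) {a b : ℝ} (hab : a + b = 1) :
    biasMatrix E A B (a • H + b • H') = a • biasMatrix E A B H + b • biasMatrix E A B H' := by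
  have hb : b = 1 - a := by linarith
  subst hb
  simp only [biasMatrix, transpose_add, transpose_smul, Matrix.add_mul, Matrix.smul_mul]
  module

lemma dotProduct_self_convexCombination_le {ι : Type*} [Fintype ι] (u v : ι → ℝ) {a b : ℝ}
    (ha : 0 ≤ a) (hb : 0 ≤ b) (hab : a + b = 1) :
    (a • u + b • v) ⬝ᵥ (a • u + b • v) ≤ a * (u ⬝ᵥ u) + b * (v ⬝ᵥ v) := by
  simp only [dotProduct, Finset.mul_sum, ← Finset.sum_add_distrib]
  refine Finset.sum_le_sum fun i _ => ?_
  simp only [Pi.add_apply, Pi.smul_apply, smul_eq_mul]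
  have hb' : b = 1 - a := by linarith
  subst hb'
  nlinarith [mul_nonneg (mul_nonneg ha hb) (sq_nonneg (u i - v i))]

/-- Tested on a fixed `x`, the left side is a convex quadratic of a quantity affine in `H`, and the
right side is linear in `(λ, D)`. This serves both the epigraph and, with `D = 0`, the feasible set.
-/
lemma biasMatrix_quadForm_convexCombination_le {H H' : Matrix (Fin m) (Fin ν) ℝ}
    {l l' : Fin K → ℝ} {D D' : Matrix (Fin nbar) (Fin nbar) ℝ} {x : Fin nbar → ℝ} {a b : ℝ}
    (ha : 0 ≤ a) (hb : 0 ≤ b) (hab : a + b = 1)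
    (h : (biasMatrix E A B H *ᵥ x) ⬝ᵥ (biasMatrix E A B H *ᵥ x) ≤
      x ⬝ᵥ ((∑ k, l k • E.S k) *ᵥ x) + x ⬝ᵥ (D *ᵥ x))
    (h' : (biasMatrix E A B H' *ᵥ x) ⬝ᵥ (biasMatrix E A B H' *ᵥ x) ≤
      x ⬝ᵥ ((∑ k, l' k • E.S k) *ᵥ x) + x ⬝ᵥ (D' *ᵥ x)) :
    (biasMatrix E A B (a • H + b • H') *ᵥ x) ⬝ᵥ (biasMatrix E A B (a • H + b • H') *ᵥ x) ≤
      x ⬝ᵥ ((∑ k, (a • l + b • l') k • E.S k) *ᵥ x) + x ⬝ᵥ ((a • D + b • D') *ᵥ x) := by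
  have e1 := mul_le_mul_of_nonneg_left h ha
  have e2 := mul_le_mul_of_nonneg_left h' hb
  have e4 : (∑ k, (a • l + b • l') k • E.S k)
      = a • (∑ k, l k • E.S k) + b • ∑ k, l' k • E.S k := by
    simp only [Finset.smul_sum, ← Finset.sum_add_distrib]
    refine Finset.sum_congr rfl fun k _ => ?_
    simp only [Pi.add_apply, Pi.smul_apply, smul_eq_mul]
    module
  have e3 := dotProduct_self_convexCombination_le (biasMatrix E A B H *ᵥ x)
    (biasMatrix E A B H' *ᵥ x) ha hb hab
  simp only [biasMatrix_convexCombination E A B H H' hab, e4]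
  simp only [add_mulVec, smul_mulVec, dotProduct_add, dotProduct_smul, smul_eq_mul] at *
  linarith

lemma convex_perturbedEpigraph : Convex ℝ (perturbedEpigraph E A B σ) := by
  rintro ⟨s, D⟩ ⟨⟨H, l⟩, h1, h2, h3⟩ ⟨s', D'⟩ ⟨⟨H', l'⟩, h1', h2', h3'⟩ a b ha hb hab
  refine ⟨(a • H + b • H', a • l + b • l'), fun k => ?_, fun t ht => ?_, fun x => ?_⟩
  · have := h1 k
    have := h1' k
    simp only [Pi.add_apply, Pi.smul_apply, smul_eq_mul] at *
    positivity
  · have e1 := h2 t ht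
    have e2 := h2' t ht
    have e3 := (convexOn_trace_transpose_mul_self (ι := Fin m) (κ := Fin ν)).2
      (Set.mem_univ H) (Set.mem_univ H') ha hb hab
    simp only [smul_eq_mul, add_dotProduct, smul_dotProduct, Prod.fst_add, Prod.smul_fst] at *
    nlinarith [mul_le_mul_of_nonneg_left e1 ha, mul_le_mul_of_nonneg_left e2 hb,
      mul_le_mul_of_nonneg_left e3 (sq_nonneg σ)]
  · exact biasMatrix_quadForm_convexCombination_le E A B ha hb hab (h3 x) (h3' x)

lemma convexOn_programObjective :
    ConvexOn ℝ (programFeasible E A B) (programObjective E σ) := by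
  constructor
  · rintro p hp q hq a b ha hb hab
    rw [mem_programFeasible_iff] at *
    refine ⟨fun k => ?_, fun x => ?_⟩
    · have := hp.1 k
      have := hq.1 k
      simp only [Prod.snd_add, Prod.smul_snd, Pi.add_apply, Pi.smul_apply, smul_eq_mul]
      positivity
    · simpa using biasMatrix_quadForm_convexCombination_le E A B (D := 0) (D' := 0) ha hb hab
        (by simpa using hp.2 x) (by simpa using hq.2 x)
  · rintro ⟨H, l⟩ - ⟨H', l'⟩ - a b ha hb hab
    have e3 := (convexOn_trace_transpose_mul_self (ι := Fin m) (κ := Fin ν)).2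
      (Set.mem_univ H) (Set.mem_univ H') ha hb hab
    have e4 := E.convexOn_supportFun.2 (Set.mem_univ l) (Set.mem_univ l') ha hb hab
    simp only [programObjective, smul_eq_mul, Prod.fst_add, Prod.smul_fst,
      Prod.snd_add, Prod.smul_snd] at *
    nlinarith [mul_le_mul_of_nonneg_left e3 (sq_nonneg σ)]

/-- A bound on the objective confines `H` because `σ > 0`, and `λ ≥ 0` because `T` contains a
positive vector, so witnesses subconverge. Closedness yields both attainment of `Opt` and strict
separation in the duality argument. -/
lemma isClosed_perturbedEpigraph (hσ : 0 < σ) : IsClosed (perturbedEpigraph E A B σ) := by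
  have : FirstCountableTopology (Matrix (Fin m) (Fin ν) ℝ × (Fin K → ℝ)) :=
    inferInstanceAs (FirstCountableTopology ((Fin m → Fin ν → ℝ) × (Fin K → ℝ)))
  have : FirstCountableTopology (Matrix (Fin nbar) (Fin nbar) ℝ) :=
    inferInstanceAs (FirstCountableTopology (Fin nbar → Fin nbar → ℝ))
  apply IsSeqClosed.isClosed
  intro z z₀ hz hlim
  choose p h1 h2 h3 using hz
  obtain ⟨t₀, ht₀, ht₀pos⟩ := E.T_meets_interior
  obtain ⟨b, hb⟩ : ∃ b, ∀ n, (z n).1 ≤ b := by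
    obtain ⟨b, hb⟩ := ((continuous_fst.tendsto z₀).comp hlim).bddAbove_range
    exact ⟨b, fun n => hb ⟨n, rfl⟩⟩
  have hlt : ∀ n k, 0 ≤ (p n).2 k * t₀ k := fun n k => mul_nonneg (h1 n k) (ht₀pos k).le
  have hdot : ∀ n, 0 ≤ (p n).2 ⬝ᵥ t₀ := fun n => Finset.sum_nonneg fun k _ => hlt n k
  have hH : ∀ n i j, (p n).1 i j ∈ Set.Icc (-(√(b / σ ^ 2))) (√(b / σ ^ 2)) := by
    intro n i j
    rw [Set.mem_Icc, ← abs_le]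
    apply Real.abs_le_sqrt
    rw [le_div_iff₀ (by positivity)]
    have := h2 n t₀ ht₀
    have := hb n
    have := hdot n
    nlinarith [mul_le_mul_of_nonneg_left (sq_le_trace_transpose_mul_self (p n).1 i j)
      (sq_nonneg σ)]
  have hl : ∀ n k, (p n).2 k ∈ Set.Icc 0 (b / t₀ k) := by
    intro n k
    refine ⟨h1 n k, ?_⟩
    rw [le_div_iff₀ (ht₀pos k)]
    have e1 : (p n).2 k * t₀ k ≤ (p n).2 ⬝ᵥ t₀ :=
      Finset.single_le_sum (f := fun k => (p n).2 k * t₀ k) (fun k _ => hlt n k)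
        (Finset.mem_univ k)
    have := h2 n t₀ ht₀
    have := hb n
    have := mul_nonneg (sq_nonneg σ) (trace_transpose_mul_self_nonneg (p n).1)
    linarith
  obtain ⟨S, hS, hpS⟩ : ∃ S : Set (Matrix (Fin m) (Fin ν) ℝ × (Fin K → ℝ)),
      IsCompact S ∧ ∀ n, p n ∈ S :=
    ⟨(Set.univ.pi fun _ => Set.univ.pi fun _ => Set.Icc (-(√(b / σ ^ 2))) (√(b / σ ^ 2))) ×ˢ
      (Set.univ.pi fun k => Set.Icc 0 (b / t₀ k)),
      IsCompact.prod (isCompact_univ_pi fun _ => isCompact_univ_pi fun _ => isCompact_Icc)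
        (isCompact_univ_pi fun _ => isCompact_Icc),
      fun n => ⟨fun i _ j _ => hH n i j, fun k _ => hl n k⟩⟩
  obtain ⟨p₀, -, φ, hφ, hp₀⟩ := hS.tendsto_subseq hpS
  have hlim' := hlim.comp hφ.tendsto_atTop
  refine ⟨p₀, fun k => ?_, fun t ht => ?_, fun x => ?_⟩
  · have hf : Continuous fun w : Matrix (Fin m) (Fin ν) ℝ × (Fin K → ℝ) => w.2 k := by fun_prop
    exact ge_of_tendsto' ((hf.tendsto p₀).comp hp₀) fun n => h1 (φ n) k
  · have hf : Continuous fun w : Matrix (Fin m) (Fin ν) ℝ × (Fin K → ℝ) =>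
      σ ^ 2 * (w.1ᵀ * w.1).trace + w.2 ⬝ᵥ t := by fun_prop
    exact le_of_tendsto_of_tendsto' ((hf.tendsto p₀).comp hp₀)
      ((continuous_fst.tendsto z₀).comp hlim') fun n => h2 (φ n) t ht
  · have hf : Continuous fun w : Matrix (Fin m) (Fin ν) ℝ × (Fin K → ℝ) =>
        (biasMatrix E A B w.1 *ᵥ x) ⬝ᵥ (biasMatrix E A B w.1 *ᵥ x) := by fun_prop
    have hg : Continuous fun w : Matrix (Fin m) (Fin ν) ℝ × (Fin K → ℝ) =>
        x ⬝ᵥ ((∑ k, w.2 k • E.S k) *ᵥ x) := by fun_prop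
    have hD : Continuous fun w : ℝ × Matrix (Fin nbar) (Fin nbar) ℝ => x ⬝ᵥ (w.2 *ᵥ x) := by
      fun_prop
    exact le_of_tendsto_of_tendsto' ((hf.tendsto p₀).comp hp₀)
      (((hg.tendsto p₀).comp hp₀).add ((hD.tendsto z₀).comp hlim')) fun n => h3 (φ n) x

end Program

/-! ### Quantitative bounds for semidefinite matrices -/

section MatrixBounds

variable {ι κ : Type*} [Fintype ι] [Fintype κ]

lemma exists_dotProduct_mulVec_self_le (G : Matrix κ ι ℝ) :
    ∃ C, 0 ≤ C ∧ ∀ x, (G *ᵥ x) ⬝ᵥ (G *ᵥ x) ≤ C * (x ⬝ᵥ x) := by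
  refine ⟨∑ i, ∑ j, G i j ^ 2, by positivity, fun x => ?_⟩
  rw [Finset.sum_mul]
  refine Finset.sum_le_sum fun i _ => ?_
  simp only [mulVec, dotProduct, ← sq]
  exact Finset.sum_mul_sq_le_sq_mul_sq _ _ _

/-- Factor `N = VᵀV` with `V` invertible; the constant is a norm bound for `V⁻¹`. -/
lemma Matrix.PosDef.exists_mul_dotProduct_self_le [DecidableEq ι] {N : Matrix ι ι ℝ}
    (hN : N.PosDef) : ∃ C, 0 ≤ C ∧ ∀ x, x ⬝ᵥ x ≤ C * (x ⬝ᵥ (N *ᵥ x)) := by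
  obtain ⟨V, rfl⟩ := hN.posSemidef.exists_eq_transpose_mul_self
  have hV : IsUnit V.det := by
    have := (Matrix.isUnit_iff_isUnit_det _).1 hN.isUnit
    rw [det_mul] at this
    exact isUnit_of_mul_isUnit_right this
  obtain ⟨C, hC, h⟩ := exists_dotProduct_mulVec_self_le V⁻¹
  refine ⟨C, hC, fun x => ?_⟩
  have := h (V *ᵥ x)
  rwa [mulVec_mulVec, nonsing_inv_mul _ hV, one_mulVec,
    ← dotProduct_transpose_mul_self_mulVec] at this

lemma trace_transpose_mul_self_mul (V N : Matrix ι ι ℝ) :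
    (Vᵀ * V * N).trace = ∑ i, V i ⬝ᵥ (N *ᵥ V i) := by
  rw [Matrix.mul_assoc, trace_mul_comm, Matrix.mul_assoc]
  simp only [trace, diag, mul_apply, dotProduct, mulVec, transpose_apply]

lemma Matrix.PosSemidef.abs_apply_le_trace [DecidableEq ι] {Q : Matrix ι ι ℝ}
    (hQ : Q.PosSemidef) (i j : ι) : |Q i j| ≤ Q.trace := by
  obtain ⟨V, rfl⟩ := hQ.exists_eq_transpose_mul_self
  rw [trace_transpose_mul_self_eq_sum, Finset.sum_comm, mul_apply]
  refine (Finset.abs_sum_le_sum_abs _ _).trans (Finset.sum_le_sum fun k _ => ?_)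
  have h1 := Finset.single_le_sum (f := fun j => V k j ^ 2) (fun _ _ => sq_nonneg _)
    (Finset.mem_univ i)
  have h2 := Finset.single_le_sum (f := fun j => V k j ^ 2) (fun _ _ => sq_nonneg _)
    (Finset.mem_univ j)
  simp only [transpose_apply, abs_mul] at *
  nlinarith [sq_abs (V k i), sq_abs (V k j), sq_nonneg (|V k i| - |V k j|)]

/-- A positive definite `N` bounds the trace of `Q` through `Tr(QN)`. -/
lemma Matrix.PosDef.exists_trace_le [DecidableEq ι] {N : Matrix ι ι ℝ} (hN : N.PosDef) :
    ∃ C, 0 ≤ C ∧ ∀ Q : Matrix ι ι ℝ, Q.PosSemidef → Q.trace ≤ C * (Q * N).trace := by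
  obtain ⟨C, hC, h⟩ := hN.exists_mul_dotProduct_self_le
  refine ⟨C, hC, fun Q hQ => ?_⟩
  obtain ⟨V, rfl⟩ := hQ.exists_eq_transpose_mul_self
  have h1 := trace_transpose_mul_self_mul V 1
  rw [Matrix.mul_one] at h1
  rw [trace_transpose_mul_self_mul, h1, Finset.mul_sum]
  exact Finset.sum_le_sum fun i _ => by simpa using h (V i)

end MatrixBounds

/-! ### Compactness of the set of admissible covariances -/

namespace Ellitope

variable {n nbar K : ℕ} (E : Ellitope n nbar K)

/-- The traces are nonnegative, so monotonicity of `T` lets them serve as `t` themselves. -/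
lemma mem_Qset_iff {Q : Matrix (Fin nbar) (Fin nbar) ℝ} :
    Q ∈ E.Qset ↔ Q.PosSemidef ∧ (fun k => (Q * E.S k).trace) ∈ E.T := by
  constructor
  · rintro ⟨hQ, t, ht, h⟩
    exact ⟨hQ, E.T_monotone t ht _ (fun k => hQ.trace_mul_nonneg (E.S_posSemidef k)) h⟩
  · rintro ⟨hQ, h⟩
    exact ⟨hQ, _, h, fun k => le_rfl⟩

/-- `∑ S_k ≻ 0` turns the bound on `∑ Tr(Q S_k)` into one on `Tr Q`, which dominates every entry of
`Q ⪰ 0`. -/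
lemma isCompact_Qset : IsCompact E.Qset := by
  obtain ⟨C, hC, hbd⟩ := E.sum_S_posDef.exists_trace_le
  set b := C * E.supportFun 1 with hb
  obtain ⟨S, hS, hmem⟩ : ∃ S : Set (Matrix (Fin nbar) (Fin nbar) ℝ), IsCompact S ∧
      ∀ Q, (∀ i j, Q i j ∈ Set.Icc (-b) b) → Q ∈ S :=
    ⟨Set.univ.pi fun _ => Set.univ.pi fun _ => Set.Icc (-b) b,
      isCompact_univ_pi fun _ => isCompact_univ_pi fun _ => isCompact_Icc,
      fun Q hQ i _ j _ => hQ i j⟩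
  refine hS.of_isClosed_subset ?_ ?_
  · have : E.Qset = {Q | Q.IsHermitian} ∩ (⋂ x, {Q | 0 ≤ x ⬝ᵥ (Q *ᵥ x)}) ∩
        (fun Q k => (Q * E.S k).trace) ⁻¹' E.T := by
      ext Q
      simp only [mem_Qset_iff, posSemidef_iff_real, Set.mem_inter_iff, Set.mem_iInter,
        Set.mem_ofPred_eq, Set.mem_preimage]
    rw [this]
    refine IsClosed.inter (IsClosed.inter ?_ (isClosed_iInter fun x => ?_)) ?_
    · exact isClosed_eq (by fun_prop) (by fun_prop)
    · exact isClosed_le (by fun_prop) (by fun_prop)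
    · exact E.T_compact.isClosed.preimage (by fun_prop)
  · intro Q hQ
    rw [mem_Qset_iff] at hQ
    have h1 : Q.trace ≤ b := by
      refine (hbd Q hQ.1).trans (mul_le_mul_of_nonneg_left ?_ hC)
      refine le_trans (le_of_eq ?_) (E.dotProduct_le_supportFun 1 hQ.2)
      rw [Matrix.mul_sum, trace_sum, one_dotProduct]
    refine hmem Q fun i j => ?_
    rw [Set.mem_Icc, ← abs_le]
    exact (hQ.1.abs_apply_le_trace i j).trans h1

lemma Qset_nonempty : E.Qset.Nonempty := by
  obtain ⟨t, ht⟩ := E.T_nonempty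
  exact ⟨0, PosSemidef.zero, t, ht, fun k => by simpa using E.T_nonneg t ht k⟩

end Ellitope

/-! ### Solvability and Lagrange duality -/

section Program

variable {m n nbar K ν : ℕ} (E : Ellitope n nbar K) (A : Matrix (Fin m) (Fin n) ℝ)
    (B : Matrix (Fin ν) (Fin n) ℝ) (σ : ℝ)

lemma isGreatest_traceValues : IsGreatest (traceValues E B) (Mstar E B ^ 2) := by
  have hc : IsCompact (traceValues E B) := E.isCompact_Qset.image (by fun_prop)
  have hg := hc.isGreatest_sSup (E.Qset_nonempty.image _)
  have h0 : 0 ≤ sSup (traceValues E B) := by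
    obtain ⟨Q, hQ, h⟩ := hg.1
    rw [← h]
    exact (hQ.1.mul_mul_conjTranspose_same (B * E.P)).trace_nonneg
  rwa [Mstar, Real.sq_sqrt h0]

lemma programFeasible_nonempty : (programFeasible E A B).Nonempty := by
  obtain ⟨C, hC, h⟩ := exists_dotProduct_mulVec_self_le (biasMatrix E A B 0)
  obtain ⟨C', hC', h'⟩ := E.sum_S_posDef.exists_mul_dotProduct_self_le
  refine ⟨(0, fun _ => C * C'), ?_⟩
  rw [mem_programFeasible_iff]
  refine ⟨fun _ => by positivity, fun x => (h x).trans ?_⟩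
  rw [← Finset.smul_sum, smul_mulVec, dotProduct_smul, smul_eq_mul, mul_assoc]
  exact mul_le_mul_of_nonneg_left (h' x) hC

lemma Ellitope.supportFun_nonneg {lam : Fin K → ℝ} (h : ∀ k, 0 ≤ lam k) :
    0 ≤ E.supportFun lam := by
  obtain ⟨t, ht⟩ := E.T_nonempty
  exact le_trans (Finset.sum_nonneg fun k _ => mul_nonneg (h k) (E.T_nonneg t ht k))
    (E.dotProduct_le_supportFun lam ht)

lemma programObjective_nonneg {p : Matrix (Fin m) (Fin ν) ℝ × (Fin K → ℝ)}
    (hp : p ∈ programFeasible E A B) : 0 ≤ programObjective E σ p :=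
  add_nonneg (mul_nonneg (sq_nonneg σ) (trace_transpose_mul_self_nonneg _))
    (E.supportFun_nonneg hp.1)

lemma bddBelow_programObjective :
    BddBelow (programObjective E σ '' programFeasible E A B) := by
  refine ⟨0, ?_⟩
  rintro _ ⟨p, hp, rfl⟩
  exact programObjective_nonneg E A B σ hp

lemma programOpt_le {p : Matrix (Fin m) (Fin ν) ℝ × (Fin K → ℝ)}
    (hp : p ∈ programFeasible E A B) : programOpt E A B σ ≤ programObjective E σ p :=
  csInf_le (bddBelow_programObjective E A B σ) ⟨p, hp, rfl⟩

lemma programOpt_mem_perturbedEpigraph (hσ : 0 < σ) :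
    (programOpt E A B σ, 0) ∈ perturbedEpigraph E A B σ := by
  have hcl : IsClosed {s : ℝ | (s, (0 : Matrix (Fin nbar) (Fin nbar) ℝ)) ∈
      perturbedEpigraph E A B σ} :=
    (isClosed_perturbedEpigraph E A B σ hσ).preimage (by fun_prop)
  refine hcl.closure_subset_iff.2 ?_ (csInf_mem_closure
    ((programFeasible_nonempty E A B).image _) (bddBelow_programObjective E A B σ))
  rintro _ ⟨p, hp, rfl⟩
  exact (mem_perturbedEpigraph_zero_iff E A B σ).2 ⟨p, hp, le_rfl⟩

lemma exists_isOptimalSolution (hσ : 0 < σ) : ∃ p, IsOptimalSolution E A B σ p := by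
  obtain ⟨p, hp, h⟩ := (mem_perturbedEpigraph_zero_iff E A B σ).1
    (programOpt_mem_perturbedEpigraph E A B σ hσ)
  exact ⟨p, hp, fun q hq => h.trans (programOpt_le E A B σ hq)⟩

lemma IsOptimalSolution.programObjective_eq {p : Matrix (Fin m) (Fin ν) ℝ × (Fin K → ℝ)}
    (hp : IsOptimalSolution E A B σ p) : programObjective E σ p = programOpt E A B σ := by
  apply le_antisymm
  · refine le_csInf ((programFeasible_nonempty E A B).image _) ?_
    rintro _ ⟨q, hq, rfl⟩
    exact hp.2 hq
  · exact programOpt_le E A B σ hp.1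

/-- At value zero, `σ > 0` forces `H = 0` and a positive `t ∈ T` forces `λ = 0`; the matrix
inequality then reads `(BP)ᵀ(BP) ⪯ 0`. -/
lemma programOpt_pos (hσ : 0 < σ) (hBP : B * E.P ≠ 0) : 0 < programOpt E A B σ := by
  obtain ⟨⟨H, l⟩, hp⟩ := exists_isOptimalSolution E A B σ hσ
  rw [← hp.programObjective_eq]
  refine lt_of_le_of_ne (programObjective_nonneg E A B σ hp.1) fun h => hBP ?_
  have hf := (mem_programFeasible_iff E A B).1 hp.1
  have h1 := mul_nonneg (sq_nonneg σ) (trace_transpose_mul_self_nonneg H)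
  have h2 := E.supportFun_nonneg hf.1
  simp only [programObjective] at h hf h2
  have hH : H = 0 := by
    ext i j
    have h3 : (Hᵀ * H).trace = 0 := by
      have : σ ^ 2 * (Hᵀ * H).trace = 0 := by linarith
      exact (mul_eq_zero.1 this).resolve_left (by positivity)
    have := sq_le_trace_transpose_mul_self H i j
    rw [h3] at this
    exact pow_eq_zero_iff two_ne_zero |>.1 (le_antisymm this (sq_nonneg _))
  have hl : l = 0 := by
    obtain ⟨t, ht, htpos⟩ := E.T_meets_interior
    have h3 : l ⬝ᵥ t ≤ 0 := (E.dotProduct_le_supportFun l ht).trans (by linarith)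
    have h4 := (Finset.sum_eq_zero_iff_of_nonneg
      (fun k _ => mul_nonneg (hf.1 k) (htpos k).le)).1 (le_antisymm h3
        (Finset.sum_nonneg fun k _ => mul_nonneg (hf.1 k) (htpos k).le))
    ext k
    exact (mul_eq_zero.1 (h4 k (Finset.mem_univ k))).resolve_right (htpos k).ne'
  subst hH hl
  ext i j
  have h5 := hf.2 (Pi.single j 1)
  simp only [biasMatrix, transpose_zero, Matrix.zero_mul, sub_zero, Pi.zero_apply, zero_smul,
    Finset.sum_const_zero, zero_mulVec, dotProduct_zero] at h5
  rw [mulVec_single_one] at h5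
  have h6 := dotProduct_self_eq_zero.1 (le_antisymm h5
    (Finset.sum_nonneg fun k _ => mul_self_nonneg _))
  exact congrFun h6 i

/-- Lagrange duality for the design program. -/
lemma exists_dual_matrix (hσ : 0 < σ) {ε : ℝ} (hε : 0 < ε) :
    ∃ Q ∈ E.Qset, ∀ H : Matrix (Fin m) (Fin ν) ℝ, programOpt E A B σ - ε ≤
      σ ^ 2 * (Hᵀ * H).trace + ((biasMatrix E A B H)ᵀ * biasMatrix E A B H * Q).trace := by
  have : LocallyConvexSpace ℝ (Matrix (Fin nbar) (Fin nbar) ℝ) :=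
    inferInstanceAs (LocallyConvexSpace ℝ (Fin nbar → Fin nbar → ℝ))
  have hnot : (programOpt E A B σ - ε, 0) ∉ perturbedEpigraph E A B σ := by
    rw [mem_perturbedEpigraph_zero_iff]
    rintro ⟨p, hp, h⟩
    linarith [programOpt_le E A B σ hp]
  -- Separating a point strictly below the optimum from the closed convex epigraph replaces any
  -- constraint qualification.
  obtain ⟨f, u, hfu, huf⟩ := geometric_hahn_banach_point_closed
    (convex_perturbedEpigraph E A B σ) (isClosed_perturbedEpigraph E A B σ hσ) hnot
  set μ : ℝ := f (1, 0) with hμ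
  set R : Matrix (Fin nbar) (Fin nbar) ℝ := fun i j => f (0, Matrix.single i j 1) with hR
  have hf : ∀ s D, f (s, D) = s * μ + ∑ i, ∑ j, D i j * R i j := by
    intro s D
    have h1 : f (s, D) = f (s, 0) + f (0, D) := by rw [← map_add]; simp
    have h2 : f (s, 0) = s * μ := by
      rw [hμ, ← smul_eq_mul, ← map_smul]; simp
    have h3 : f (0, D) = ∑ i, ∑ j, D i j * R i j := by
      conv_lhs => rw [matrix_eq_sum_single D]
      have : ∀ D, f (0, D) = (f.toLinearMap ∘ₗ LinearMap.inr ℝ ℝ _) D := fun D => rfl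
      simp only [this, map_sum]
      refine Finset.sum_congr rfl fun i _ => Finset.sum_congr rfl fun j _ => ?_
      have h4 : Matrix.single i j (D i j) = D i j • Matrix.single i j (1 : ℝ) := by simp
      rw [h4, map_smul, smul_eq_mul]
      rfl
    rw [h1, h2, h3]
  have hOpt := huf _ (programOpt_mem_perturbedEpigraph E A B σ hσ)
  -- The hyperplane is not vertical: it separates `(Opt - ε, 0)` from `(Opt, 0)`.
  have hμpos : 0 < μ := by
    rw [hf] at hOpt hfu
    have : 0 < ε * μ := by linarith
    exact pos_of_mul_pos_right (by linarith) hε.le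
  have hlag : ∀ z ∈ perturbedEpigraph E A B σ,
      programOpt E A B σ - ε ≤ z.1 + (∑ i, ∑ j, z.2 i j * R i j) / μ := by
    rintro ⟨s, D⟩ hz
    have h1 := huf _ hz
    rw [hf] at h1 hfu
    simp only [Matrix.zero_apply, zero_mul, Finset.sum_const_zero, add_zero] at hfu
    rw [← sub_le_iff_le_add', le_div_iff₀ hμpos]
    simp only
    linarith
  -- The multiplier, normalized by `μ` and symmetrized; symmetrizing is harmless since it is paired
  -- only with symmetric `D`.
  set Q : Matrix (Fin nbar) (Fin nbar) ℝ := (2 * μ)⁻¹ • (R + Rᵀ) with hQdef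
  have hpair : ∀ D : Matrix (Fin nbar) (Fin nbar) ℝ, D.IsHermitian →
      (∑ i, ∑ j, D i j * R i j) / μ = (D * Q).trace := by
    intro D hD
    have h1 : (D * Rᵀ).trace = ∑ i, ∑ j, D i j * R i j := by
      simp [trace, mul_apply]
    have h2 : (D * R).trace = ∑ i, ∑ j, D i j * R i j := by
      rw [← h1, ← trace_transpose, transpose_mul, trace_mul_comm]
      exact congrArg (fun M => (M * Rᵀ).trace) hD.eq
    rw [hQdef, Matrix.mul_smul, Matrix.mul_add, trace_smul, trace_add, h1, h2, smul_eq_mul]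
    field_simp
    ring
  have hM : ∀ H, ((biasMatrix E A B H)ᵀ * biasMatrix E A B H).IsHermitian := fun H =>
    isHermitian_conjTranspose_mul_self _
  -- the Lagrangian inequality
  have hL : ∀ (H : Matrix (Fin m) (Fin ν) ℝ) (l : Fin K → ℝ)
      (Z : Matrix (Fin nbar) (Fin nbar) ℝ), (∀ k, 0 ≤ l k) → Z.PosSemidef →
      programOpt E A B σ - ε ≤ σ ^ 2 * (Hᵀ * H).trace + E.supportFun l +
        (((biasMatrix E A B H)ᵀ * biasMatrix E A B H * Q).trace
          - ∑ k, l k * (Q * E.S k).trace + (Z * Q).trace) := by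
    intro H l Z hl hZ
    -- This perturbation makes any `(H, l)` with `l ≥ 0` admissible, leaving exactly the surplus `Z
    -- ⪰ 0`.
    set D := (biasMatrix E A B H)ᵀ * biasMatrix E A B H - ∑ k, l k • E.S k + Z with hD
    have hDh : D.IsHermitian := by
      refine ((hM H).sub ?_).add hZ.isHermitian
      unfold IsHermitian
      rw [conjTranspose_sum]
      refine Finset.sum_congr rfl fun k _ => ?_
      rw [conjTranspose_smul, (E.S_posSemidef k).isHermitian.eq]; simp
    have h1 := hlag (σ ^ 2 * (Hᵀ * H).trace + E.supportFun l, D)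
      ⟨(H, l), hl, (programObjective_le_iff E σ).1 le_rfl, fun x => ?_⟩
    · refine h1.trans (le_of_eq ?_)
      simp only [hpair D hDh]
      congr 1
      rw [hD, Matrix.add_mul, Matrix.sub_mul, Finset.sum_mul, trace_add, trace_sub, trace_sum]
      congr 2
      refine Finset.sum_congr rfl fun k _ => ?_
      rw [Matrix.smul_mul, trace_smul, trace_mul_comm, smul_eq_mul]
    · have := (posSemidef_iff_real.1 hZ).2 x
      simp only [hD, add_mulVec, sub_mulVec, dotProduct_add, dotProduct_sub,
        dotProduct_transpose_mul_self_mulVec]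
      linarith
  -- The Lagrangian is bounded below while `(l, Z)` ranges over a cone; a violation, scaled by `c`,
  -- would drive it to `-∞`. The choice `c * d = |a| + 1` already contradicts `c * d ≤ a`.
  have hcone : ∀ (l : Fin K → ℝ) (Z : Matrix (Fin nbar) (Fin nbar) ℝ), (∀ k, 0 ≤ l k) →
      Z.PosSemidef → ∑ k, l k * (Q * E.S k).trace ≤ E.supportFun l + (Z * Q).trace := by
    intro l Z hl hZ
    by_contra! hlt
    set a := ((biasMatrix E A B 0)ᵀ * biasMatrix E A B 0 * Q).trace - programOpt E A B σ + ε
      with ha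
    set d := ∑ k, l k * (Q * E.S k).trace - (E.supportFun l + (Z * Q).trace) with hd
    have hd0 : 0 < d := sub_pos.2 hlt
    set c := (|a| + 1) / d with hc
    have hc0 : 0 ≤ c := by positivity
    have h1 := hL 0 (c • l) (c • Z) (fun k => mul_nonneg hc0 (hl k)) (hZ.smul hc0)
    have h2 := E.supportFun_smul l hc0
    have h3 : ∑ k, (c • l) k * (Q * E.S k).trace = c * ∑ k, l k * (Q * E.S k).trace := by
      rw [Finset.mul_sum]
      exact Finset.sum_congr rfl fun k _ => by simp [mul_assoc]
    have h4 : c * d = |a| + 1 := by rw [hc]; field_simp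
    rw [h3, Matrix.smul_mul, trace_smul, smul_eq_mul] at h1
    simp only [transpose_zero, Matrix.zero_mul, trace_zero, mul_zero] at h1
    rw [hd] at h4
    have := le_abs_self a
    simp only [biasMatrix, transpose_zero, Matrix.zero_mul] at h1 ha
    linarith
  have hQ : Q.PosSemidef := by
    rw [posSemidef_iff_real]
    refine ⟨?_, fun x => ?_⟩
    · unfold IsHermitian
      simp [hQdef, add_comm]
    -- Rank-one `Z` gives `Q ⪰ 0`; below, `Z = 0` puts the traces in `T`.
    · have h1 := hcone 0 (vecMulVec x x) (fun _ => le_rfl) (by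
        simpa using posSemidef_vecMulVec_self_star x)
      rw [trace_mul_comm, trace_mul_vecMulVec_self, E.supportFun_zero] at h1
      simpa using h1
  refine ⟨Q, E.mem_Qset_iff.2 ⟨hQ, ?_⟩, fun H => ?_⟩
  · refine E.mem_T_of_forall_dotProduct_le
      (fun k => hQ.trace_mul_nonneg (E.S_posSemidef k)) fun l hl => ?_
    simpa [dotProduct] using hcone l 0 hl PosSemidef.zero
  · simpa [E.supportFun_zero] using hL H 0 0 (fun _ => le_rfl) PosSemidef.zero

/-- In `exists_dual_matrix` the bounds `t` on `Tr(Q S_k)` may be taken positive. -/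
lemma exists_dual_matrix_pos (hσ : 0 < σ) {ε : ℝ} (hε : 0 < ε) :
    ∃ Q : Matrix (Fin nbar) (Fin nbar) ℝ, Q ∈ E.Qset ∧
      (∃ t ∈ E.T, (∀ k, 0 < t k) ∧ ∀ k, (Q * E.S k).trace ≤ t k) ∧
      ∀ H : Matrix (Fin m) (Fin ν) ℝ, programOpt E A B σ - ε ≤
        σ ^ 2 * (Hᵀ * H).trace + ((biasMatrix E A B H)ᵀ * biasMatrix E A B H * Q).trace := by
  obtain ⟨Q, hQ, h⟩ := exists_dual_matrix E A B σ hσ (half_pos hε)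
  obtain ⟨t₀, ht₀, hpos⟩ := E.T_meets_interior
  -- Shrinking `Q` to `(1 - δ)Q` makes room for `δ t₀` in the trace bounds, at a loss of at most `δ
  -- Opt ≤ ε/2`.
  obtain ⟨δ, hδ0, hδ1, hδ⟩ : ∃ δ : ℝ, 0 < δ ∧ δ < 1 ∧ δ * programOpt E A B σ ≤ ε / 2 := by
    refine ⟨min (1 / 2) (ε / 2 / (|programOpt E A B σ| + 1)), by positivity,
      (min_le_left _ _).trans_lt (by norm_num), ?_⟩
    refine (mul_le_mul_of_nonneg_left (le_abs_self _) (by positivity)).trans ?_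
    refine (mul_le_mul_of_nonneg_right (min_le_right _ _) (abs_nonneg _)).trans ?_
    rw [div_mul_eq_mul_div, div_le_iff₀ (by positivity)]
    nlinarith
  have ht := (E.mem_Qset_iff.1 hQ).2
  have hmem := E.T_convex ht ht₀ (sub_nonneg.2 hδ1.le) hδ0.le (by ring)
  have htr : ∀ k, (((1 - δ) • Q) * E.S k).trace ≤
      ((1 - δ) • (fun k => (Q * E.S k).trace) + δ • t₀) k := by
    intro k
    rw [Matrix.smul_mul, trace_smul]
    simpa using mul_nonneg hδ0.le (hpos k).le
  refine ⟨(1 - δ) • Q, ⟨hQ.1.smul (sub_nonneg.2 hδ1.le), _, hmem, htr⟩, ⟨_, hmem, ?_, htr⟩, ?_⟩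
  · intro k
    have h1 := hQ.1.trace_mul_nonneg (E.S_posSemidef k)
    have h2 := mul_nonneg (sub_nonneg.2 hδ1.le) h1
    have h3 := mul_pos hδ0 (hpos k)
    simp only [Pi.add_apply, Pi.smul_apply, smul_eq_mul]
    linarith
  · intro H
    rw [Matrix.mul_smul, trace_smul, smul_eq_mul]
    have h1 := mul_le_mul_of_nonneg_left (h H) (sub_nonneg.2 hδ1.le)
    have h2 := mul_nonneg hδ0.le
      (mul_nonneg (sq_nonneg σ) (trace_transpose_mul_self_nonneg H))
    nlinarith

end Program

/-! ### Exponential moments of Gaussian quadratic forms -/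

section GaussianExp

open scoped RealInnerProductSpace

/-- `E exp(3 Z² / (8 v)) ≤ 2` for a centered Gaussian `Z` of variance `v`. -/
lemma lintegral_exp_sq_gaussianReal_le (v : NNReal) :
    ∫⁻ z, ENNReal.ofReal (Real.exp (3 / 8 * (z ^ 2 / v))) ∂(gaussianReal 0 v) ≤ 2 := by
  by_cases hv : v = 0
  · subst hv
    simp
  have hv' : (0 : ℝ) < v := by positivity
  -- Since `3/8 - 1/2 = -1/8`, the integrand is twice the density of `N(0, 4v)`.
  have hb : (0 : ℝ) < 1 / (8 * v) := by positivity
  rw [gaussianReal_of_var_ne_zero 0 hv,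
    lintegral_withDensity_eq_lintegral_mul _ (measurable_gaussianPDF 0 v) (by fun_prop)]
  have h1 : ∀ z : ℝ, (gaussianPDF 0 v * fun z => ENNReal.ofReal (Real.exp (3 / 8 * (z ^ 2 / v)))) z
      = ENNReal.ofReal ((√(2 * Real.pi * v))⁻¹ * Real.exp (-(1 / (8 * v)) * z ^ 2)) := by
    intro z
    simp only [Pi.mul_apply, gaussianPDF_def, gaussianPDFReal_def]
    rw [← ENNReal.ofReal_mul (by positivity), mul_assoc, ← Real.exp_add]
    congr 3
    field_simp
    ring
  simp_rw [h1]
  rw [← ofReal_integral_eq_lintegral_ofReal ((integrable_exp_neg_mul_sq hb).const_mul _)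
    (Filter.Eventually.of_forall fun z => by positivity), integral_const_mul, integral_gaussian]
  have h2 : (√(2 * Real.pi * v))⁻¹ * √(Real.pi / (1 / (8 * v))) = 2 := by
    have : Real.pi / (1 / (8 * v)) = 2 ^ 2 * (2 * Real.pi * v) := by field_simp; ring
    rw [this, Real.sqrt_mul (by positivity) (2 * Real.pi * v), Real.sqrt_sq (by norm_num)]
    have : √(2 * Real.pi * v) ≠ 0 := by positivity
    field_simp
  rw [h2]
  simp

/-- Jensen's inequality for `exp` with subprobability weights. -/
lemma exp_sum_le_of_sum_le_one {ι : Type*} [Fintype ι] (p x : ι → ℝ) (hp : ∀ i, 0 ≤ p i)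
    (hsum : ∑ i, p i ≤ 1) :
    Real.exp (∑ i, p i * x i) ≤ ∑ i, p i * Real.exp (x i) + (1 - ∑ i, p i) := by
  -- The extra atom `none` carries the missing mass at the value 0.
  have h := convexOn_exp.map_sum_le (t := (Finset.univ : Finset (Option ι)))
    (w := fun o => o.elim (1 - ∑ i, p i) p) (p := fun o => o.elim 0 x)
    (by rintro (_ | i) _ <;> simp [hp, hsum]) (by simp) (by simp)
  simpa [Fintype.sum_option, add_comm] using h

variable {ι : Type*} [Fintype ι]

lemma inner_toLp_eq_dotProduct (u : ι → ℝ) (y : EuclideanSpace ℝ ι) :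
    ⟪WithLp.toLp 2 u, y⟫ = u ⬝ᵥ y.ofLp := by
  simp [PiLp.inner_apply, dotProduct, mul_comm]

variable [DecidableEq ι]

lemma map_inner_multivariateGaussian {R : Matrix ι ι ℝ} (hR : R.PosSemidef)
    (u : EuclideanSpace ℝ ι) :
    (multivariateGaussian 0 R).map (fun y => ⟪u, y⟫) =
      gaussianReal 0 (u.ofLp ⬝ᵥ (R *ᵥ u.ofLp)).toNNReal := by
  have h := IsGaussian.map_eq_gaussianReal (μ := multivariateGaussian 0 R) (innerSL ℝ u)
  have h1 : (multivariateGaussian 0 R)[innerSL ℝ u] = 0 := by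
    rw [ContinuousLinearMap.integral_comp_id_comm IsGaussian.integrable_id]
    simp
  have h2 : Var[innerSL ℝ u; multivariateGaussian 0 R] = u.ofLp ⬝ᵥ (R *ᵥ u.ofLp) := by
    rw [← covarianceBilin_multivariateGaussian (μ := 0) hR u u,
      covarianceBilin_self IsGaussian.memLp_two_id]
    rfl
  rw [h1, h2] at h
  exact h

/-- If `Tr(RW) ≤ 3/8`, then `E exp(yᵀ W y) ≤ 2` for `y ∼ N(0, R)`. -/
lemma lintegral_exp_quadForm_le {R W : Matrix ι ι ℝ} (hR : R.PosSemidef) (hW : W.PosSemidef)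
    (htr : (R * W).trace ≤ 3 / 8) :
    ∫⁻ y, ENNReal.ofReal (Real.exp (y.ofLp ⬝ᵥ (W *ᵥ y.ofLp))) ∂(multivariateGaussian 0 R) ≤ 2 := by
  obtain ⟨U, rfl⟩ := hW.exists_eq_transpose_mul_self
  -- With `W = UᵀU`, the form is the sum of squares of the Gaussians `⟪U i, y⟫`, whose variances `c
  -- i` add up to `Tr(RW)`. The weights `p i = 8 c i / 3` put it in the form required by Jensen's
  -- inequality, without independence.
  set c : ι → ℝ := fun i => U i ⬝ᵥ (R *ᵥ U i) with hc
  have hc0 : ∀ i, 0 ≤ c i := fun i => (posSemidef_iff_real.1 hR).2 (U i)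
  have hcsum : ∑ i, c i ≤ 3 / 8 := by
    refine le_trans (le_of_eq ?_) htr
    rw [trace_mul_comm, Matrix.mul_assoc, trace_mul_comm, Matrix.mul_assoc]
    simp only [hc, trace, diag, mul_apply, dotProduct, mulVec, transpose_apply]
  set p : ι → ℝ := fun i => 8 / 3 * c i with hp
  have hp0 : ∀ i, 0 ≤ p i := fun i => mul_nonneg (by norm_num) (hc0 i)
  have hpsum : ∑ i, p i ≤ 1 := by
    rw [hp, ← Finset.mul_sum]; linarith
  set g : ι → EuclideanSpace ℝ ι → ℝ :=
    fun i y => Real.exp (3 / 8 * (⟪WithLp.toLp 2 (U i), y⟫ ^ 2 / c i)) with hg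
  have hmap : ∀ i, (multivariateGaussian 0 R).map (fun y => ⟪WithLp.toLp 2 (U i), y⟫) =
      gaussianReal 0 (c i).toNNReal := fun i => map_inner_multivariateGaussian hR _
  have hint : ∀ i, ∫⁻ y, ENNReal.ofReal (g i y) ∂(multivariateGaussian 0 R) ≤ 2 := by
    intro i
    have h1 := lintegral_exp_sq_gaussianReal_le (c i).toNNReal
    rw [← hmap i, lintegral_map (by fun_prop) (by fun_prop), Real.coe_toNNReal _ (hc0 i)] at h1
    exact h1
  -- Division by `c i = 0` would drop a term; that term vanishes almost surely.
  have hzero : ∀ i, ∀ᵐ y ∂(multivariateGaussian 0 R), c i = 0 → ⟪WithLp.toLp 2 (U i), y⟫ = 0 := by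
    intro i
    by_cases hi : c i = 0
    · have h1 := hmap i
      rw [hi, Real.toNNReal_zero, gaussianReal_zero_var] at h1
      have h2 : ∀ᵐ z ∂((multivariateGaussian 0 R).map (fun y => ⟪WithLp.toLp 2 (U i), y⟫)),
          z = 0 := by
        rw [h1, ae_dirac_eq]; rfl
      filter_upwards [ae_of_ae_map (by fun_prop) h2] with y hy _ using hy
    · exact Filter.Eventually.of_forall fun y h => absurd h hi
  have hle : ∀ᵐ y ∂(multivariateGaussian 0 R),
      ENNReal.ofReal (Real.exp (y.ofLp ⬝ᵥ ((Uᵀ * U) *ᵥ y.ofLp))) ≤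
        ∑ i, ENNReal.ofReal (p i) * ENNReal.ofReal (g i y) + ENNReal.ofReal (1 - ∑ i, p i) := by
    filter_upwards [ae_all_iff.2 hzero] with y hy
    have h1 : y.ofLp ⬝ᵥ ((Uᵀ * U) *ᵥ y.ofLp) =
        ∑ i, p i * (3 / 8 * (⟪WithLp.toLp 2 (U i), y⟫ ^ 2 / c i)) := by
      rw [dotProduct_transpose_mul_self_mulVec]
      refine Finset.sum_congr rfl fun i _ => ?_
      have h2 : (U *ᵥ y.ofLp) i = ⟪WithLp.toLp 2 (U i), y⟫ := (inner_toLp_eq_dotProduct _ _).symm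
      rw [h2, hp]
      by_cases hi : c i = 0
      · rw [hy i hi]; simp
      · field_simp
    rw [h1]
    have h3 := exp_sum_le_of_sum_le_one p
      (fun i => 3 / 8 * (⟪WithLp.toLp 2 (U i), y⟫ ^ 2 / c i)) hp0 hpsum
    refine (ENNReal.ofReal_le_ofReal h3).trans (le_of_eq ?_)
    rw [ENNReal.ofReal_add (Finset.sum_nonneg fun i _ => mul_nonneg (hp0 i) (Real.exp_nonneg _))
      (sub_nonneg.2 hpsum), ENNReal.ofReal_sum_of_nonneg
      (fun i _ => mul_nonneg (hp0 i) (Real.exp_nonneg _))]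
    congr 1
    exact Finset.sum_congr rfl fun i _ => ENNReal.ofReal_mul (hp0 i)
  have hgm : ∀ i, Measurable fun y => ENNReal.ofReal (g i y) := fun i => by
    simp only [hg]; fun_prop
  calc _ ≤ ∫⁻ y, (∑ i, ENNReal.ofReal (p i) * ENNReal.ofReal (g i y) +
        ENNReal.ofReal (1 - ∑ i, p i)) ∂(multivariateGaussian 0 R) := lintegral_mono_ae hle
    _ = ∑ i, ENNReal.ofReal (p i) * ∫⁻ y, ENNReal.ofReal (g i y) ∂(multivariateGaussian 0 R) +
        ENNReal.ofReal (1 - ∑ i, p i) := by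
      rw [lintegral_add_right _ measurable_const, lintegral_finsetSum _
        (fun i _ => (hgm i).const_mul _)]
      simp only [lintegral_const, measure_univ, mul_one]
      congr 1
      exact Finset.sum_congr rfl fun i _ => lintegral_const_mul _ (hgm i)
    _ ≤ ∑ i, ENNReal.ofReal (p i) * 2 + ENNReal.ofReal (1 - ∑ i, p i) := by
      gcongr with i
      exact hint i
    _ = ENNReal.ofReal (∑ i, p i * 2 + (1 - ∑ i, p i)) := by
      rw [ENNReal.ofReal_add (Finset.sum_nonneg fun i _ => mul_nonneg (hp0 i) (by norm_num))
        (sub_nonneg.2 hpsum), ENNReal.ofReal_sum_of_nonneg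
        (fun i _ => mul_nonneg (hp0 i) (by norm_num))]
      congr 1
      exact Finset.sum_congr rfl fun i _ => by rw [ENNReal.ofReal_mul (hp0 i)]; simp
    _ ≤ 2 := by
      rw [← Finset.sum_mul]
      refine (ENNReal.ofReal_le_ofReal (show _ ≤ (2 : ℝ) by linarith)).trans (by simp)

end GaussianExp

/-! ### Second moments and covariances -/

section GaussianMoments

open scoped RealInnerProductSpace

lemma lintegral_sq_gaussianReal (a : ℝ) (v : NNReal) :
    ∫⁻ z, ENNReal.ofReal (z ^ 2) ∂(gaussianReal a v) = ENNReal.ofReal (a ^ 2 + v) := by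
  have hmem : MemLp (id : ℝ → ℝ) 2 (gaussianReal a v) := IsGaussian.memLp_two_id
  have h := variance_eq_sub hmem
  rw [variance_id_gaussianReal] at h
  simp only [Pi.pow_apply, id_eq, integral_id_gaussianReal] at h
  have hint : Integrable (fun z : ℝ => z ^ 2) (gaussianReal a v) := hmem.integrable_sq
  rw [← ofReal_integral_eq_lintegral_ofReal hint
    (Filter.Eventually.of_forall fun z => sq_nonneg z)]
  congr 1
  linarith

lemma enorm_sq_eq_ofReal_norm_sq {F : Type*} [NormedAddCommGroup F] (x : F) :
    ‖x‖ₑ ^ 2 = ENNReal.ofReal (‖x‖ ^ 2) := by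
  rw [ENNReal.ofReal_pow (norm_nonneg _), ofReal_norm]

variable {ι κ : Type*} [Fintype ι] [DecidableEq ι] [Fintype κ]

/-- Coordinate by coordinate, a Gaussian's second moment is squared mean plus variance. -/
lemma lintegral_enorm_add_sq_multivariateGaussian {R : Matrix ι ι ℝ} (hR : R.PosSemidef)
    (a : EuclideanSpace ℝ κ) (G : Matrix κ ι ℝ) :
    ∫⁻ y, ‖a + G.toEuclideanLin y‖ₑ ^ 2 ∂(multivariateGaussian 0 R) =
      ENNReal.ofReal (‖a‖ ^ 2 + (G * R * Gᵀ).trace) := by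
  have h1 : ∀ y : EuclideanSpace ℝ ι, ‖a + G.toEuclideanLin y‖ₑ ^ 2 =
      ∑ i, ENNReal.ofReal ((a i + ⟪WithLp.toLp 2 (G i), y⟫) ^ 2) := by
    intro y
    rw [enorm_sq_eq_ofReal_norm_sq, EuclideanSpace.real_norm_sq_eq,
      ENNReal.ofReal_sum_of_nonneg fun i _ => sq_nonneg _]
    refine Finset.sum_congr rfl fun i _ => ?_
    rw [inner_toLp_eq_dotProduct]
    rfl
  have h2 : ∀ i, ∫⁻ y, ENNReal.ofReal ((a i + ⟪WithLp.toLp 2 (G i), y⟫) ^ 2)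
      ∂(multivariateGaussian 0 R) = ENNReal.ofReal (a i ^ 2 + G i ⬝ᵥ (R *ᵥ G i)) := by
    intro i
    have h3 := lintegral_sq_gaussianReal (a i) (G i ⬝ᵥ (R *ᵥ G i)).toNNReal
    rw [Real.coe_toNNReal _ ((posSemidef_iff_real.1 hR).2 (G i))] at h3
    have h4 := gaussianReal_map_const_add (μ := 0) (v := (G i ⬝ᵥ (R *ᵥ G i)).toNNReal) (a i)
    rw [zero_add] at h4
    rw [← h3, ← h4, ← map_inner_multivariateGaussian hR (WithLp.toLp 2 (G i)),
      lintegral_map (by fun_prop) (by fun_prop), lintegral_map (by fun_prop) (by fun_prop)]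
  simp_rw [h1]
  rw [lintegral_finsetSum _ (fun i _ => by fun_prop)]
  simp_rw [h2]
  rw [← ENNReal.ofReal_sum_of_nonneg fun i _ => add_nonneg (sq_nonneg _)
    ((posSemidef_iff_real.1 hR).2 (G i)), Finset.sum_add_distrib, EuclideanSpace.real_norm_sq_eq]
  congr 2
  rw [Matrix.mul_assoc]
  simp only [trace, diag, mul_apply, dotProduct, mulVec, transpose_apply]

lemma lintegral_enorm_add_sq_stdGaussian (a : EuclideanSpace ℝ κ) (G : Matrix κ ι ℝ) :
    ∫⁻ y, ‖a + G.toEuclideanLin y‖ₑ ^ 2 ∂(stdGaussian (EuclideanSpace ℝ ι)) =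
      ENNReal.ofReal (‖a‖ ^ 2 + (G * Gᵀ).trace) := by
  rw [← multivariateGaussian_zero_one, lintegral_enorm_add_sq_multivariateGaussian PosSemidef.one,
    Matrix.mul_one]

/-- The covariance of two linear functionals under a product measure. -/
lemma covariance_prod_inner {F F' : Type*} [NormedAddCommGroup F] [InnerProductSpace ℝ F]
    [FiniteDimensional ℝ F] [MeasurableSpace F] [BorelSpace F]
    [NormedAddCommGroup F'] [InnerProductSpace ℝ F'] [FiniteDimensional ℝ F']
    [MeasurableSpace F'] [BorelSpace F'] {μ : Measure F} {μ' : Measure F'}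
    [IsGaussian μ] [IsGaussian μ'] (a b : F) (a' b' : F') :
    cov[fun p => ⟪a, p.1⟫ + ⟪a', p.2⟫, fun p => ⟪b, p.1⟫ + ⟪b', p.2⟫; μ.prod μ'] =
      covarianceBilin μ a b + covarianceBilin μ' a' b' := by
  have hid : MemLp (id : F → F) 2 μ := IsGaussian.memLp_two_id
  have hid' : MemLp (id : F' → F') 2 μ' := IsGaussian.memLp_two_id
  have h1 : ∀ c : F, MemLp (fun p : F × F' => ⟪c, p.1⟫) 2 (μ.prod μ') := fun c =>
    ((innerSL ℝ c).comp_memLp' hid).comp_fst μ'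
  have h2 : ∀ c : F', MemLp (fun p : F × F' => ⟪c, p.2⟫) 2 (μ.prod μ') := fun c =>
    ((innerSL ℝ c).comp_memLp' hid').comp_snd μ
  have h3 : ∀ c c' : F, cov[fun p : F × F' => ⟪c, p.1⟫, fun p => ⟪c', p.1⟫; μ.prod μ'] =
      covarianceBilin μ c c' := by
    intro c c'
    rw [covarianceBilin_apply_eq_cov hid]
    conv_rhs => rw [← Measure.fst_prod (μ := μ) (ν := μ'), Measure.fst,
      covariance_map_fun (by fun_prop) (by fun_prop) (by fun_prop)]
  have h4 : ∀ c c' : F', cov[fun p : F × F' => ⟪c, p.2⟫, fun p => ⟪c', p.2⟫; μ.prod μ'] =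
      covarianceBilin μ' c c' := by
    intro c c'
    rw [covarianceBilin_apply_eq_cov hid']
    conv_rhs => rw [← Measure.snd_prod (μ := μ) (ν := μ'), Measure.snd,
      covariance_map_fun (by fun_prop) (by fun_prop) (by fun_prop)]
  have h5 : ∀ (c : F) (c' : F'),
      cov[fun p : F × F' => ⟪c, p.1⟫, fun p => ⟪c', p.2⟫; μ.prod μ'] = 0 := fun c c' =>
    covariance_fst_snd_prod (X := fun y => ⟪c, y⟫) (Y := fun y => ⟪c', y⟫)
      ((innerSL ℝ c).comp_memLp' hid) ((innerSL ℝ c').comp_memLp' hid')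
  have h6 := covariance_add_left (h1 a) (h2 a') ((h1 b).add (h2 b'))
  rw [covariance_add_right (h1 a) (h1 b) (h2 b'), covariance_add_right (h2 a') (h1 b) (h2 b'),
    h3, h4, h5,
    covariance_comm (fun p : F × F' => ⟪a', p.2⟫) (fun p => ⟪b, p.1⟫), h5] at h6
  refine Eq.trans h6 ?_
  ring

end GaussianMoments

/-! ### Bayes optimality of linear estimates -/

section Bayes

open scoped RealInnerProductSpace

lemma toEuclideanLin_mul_apply {ι κ τ : Type*} [Fintype ι] [DecidableEq ι] [Fintype κ]
    [DecidableEq κ] (M : Matrix τ κ ℝ) (N : Matrix κ ι ℝ) (y : EuclideanSpace ℝ ι) :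
    (M * N).toEuclideanLin y = M.toEuclideanLin (N.toEuclideanLin y) := by
  ext i
  simp [toLpLin_apply, mulVec_mulVec]

lemma inner_toEuclideanLin {ι κ : Type*} [Fintype ι] [DecidableEq ι] [Fintype κ] [DecidableEq κ]
    (M : Matrix κ ι ℝ) (x : EuclideanSpace ℝ κ) (y : EuclideanSpace ℝ ι) :
    ⟪x, M.toEuclideanLin y⟫ = ⟪Mᵀ.toEuclideanLin x, y⟫ := by
  rw [toLpLin_apply 2 2 Mᵀ, inner_toLp_eq_dotProduct, ← WithLp.toLp_ofLp 2 x,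
    inner_toLp_eq_dotProduct, WithLp.ofLp_toLp, toLpLin_apply, dotProduct_mulVec,
    mulVec_transpose]

variable {d m ν : ℕ}

/-- The covariance matrix `ARBᵀ - (σ²I + ARAᵀ)H` of `Ay + σξ` and `By - Hᵀ(Ay + σξ)` vanishes
for a suitable `H`. -/
lemma exists_orthogonal_linear_estimate {R : Matrix (Fin d) (Fin d) ℝ} (hR : R.PosSemidef)
    (A : Matrix (Fin m) (Fin d) ℝ) (B : Matrix (Fin ν) (Fin d) ℝ) {σ : ℝ} (hσ : 0 < σ) :
    ∃ H : Matrix (Fin m) (Fin ν) ℝ, A * R * (B - Hᵀ * A)ᵀ = σ ^ 2 • H := by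
  -- The covariance of the observation, invertible even for singular `R` because `σ > 0`; `H` solves
  -- the normal equations `N H = A R Bᵀ`.
  set N : Matrix (Fin m) (Fin m) ℝ := A * R * Aᵀ + σ ^ 2 • 1 with hN
  have hpd : N.PosDef :=
    PosDef.posSemidef_add (hR.mul_mul_conjTranspose_same A)
      (PosDef.one.smul (by positivity : (0 : ℝ) < σ ^ 2))
  have hdet : IsUnit N.det := (Matrix.isUnit_iff_isUnit_det _).1 hpd.isUnit
  refine ⟨N⁻¹ * (A * R * Bᵀ), ?_⟩
  set H := N⁻¹ * (A * R * Bᵀ) with hH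
  have h1 : N * H = A * R * Bᵀ := by rw [hH, ← Matrix.mul_assoc, mul_nonsing_inv _ hdet,
    Matrix.one_mul]
  have h2 : N * H = A * R * Aᵀ * H + σ ^ 2 • H := by
    rw [hN, Matrix.add_mul, Matrix.smul_mul, Matrix.one_mul]
  have h3 : A * R * (Aᵀ * H) = A * R * Aᵀ * H := by simp only [Matrix.mul_assoc]
  rw [transpose_sub, transpose_mul, transpose_transpose, Matrix.mul_sub, h3, ← h1, h2,
    add_sub_cancel_left]

/-- Mean squared error of a linear functional of independent centered Gaussian vectors. -/
lemma lintegral_enorm_sub_sq_prod {R : Matrix (Fin d) (Fin d) ℝ} (hR : R.PosSemidef)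
    (G : Matrix (Fin ν) (Fin d) ℝ) (H : Matrix (Fin m) (Fin ν) ℝ) (σ : ℝ)
    (c : EuclideanSpace ℝ (Fin ν)) :
    ∫⁻ y, ∫⁻ ξ, ‖c - (G.toEuclideanLin y - σ • Hᵀ.toEuclideanLin ξ)‖ₑ ^ 2
      ∂(stdGaussian (EuclideanSpace ℝ (Fin m))) ∂(multivariateGaussian 0 R) =
    ENNReal.ofReal (‖c‖ ^ 2 + (σ ^ 2 * (Hᵀ * H).trace + (G * R * Gᵀ).trace)) := by
  have h0 : 0 ≤ σ ^ 2 * (Hᵀ * H).trace :=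
    mul_nonneg (sq_nonneg σ) (trace_transpose_mul_self_nonneg H)
  have h1 : ∀ y : EuclideanSpace ℝ (Fin d),
      ∫⁻ ξ, ‖c - (G.toEuclideanLin y - σ • Hᵀ.toEuclideanLin ξ)‖ₑ ^ 2
      ∂(stdGaussian (EuclideanSpace ℝ (Fin m))) =
      ‖c + (-G).toEuclideanLin y‖ₑ ^ 2 + ENNReal.ofReal (σ ^ 2 * (Hᵀ * H).trace) := by
    intro y
    have h2 := lintegral_enorm_add_sq_stdGaussian (c + (-G).toEuclideanLin y) (σ • Hᵀ)
    have h3 : (σ • Hᵀ * (σ • Hᵀ)ᵀ).trace = σ ^ 2 * (Hᵀ * H).trace := by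
      rw [transpose_smul, transpose_transpose, Matrix.smul_mul, Matrix.mul_smul, smul_smul,
        trace_smul, smul_eq_mul, sq]
    rw [h3, ENNReal.ofReal_add (sq_nonneg _) h0, ← enorm_sq_eq_ofReal_norm_sq] at h2
    rw [← h2]
    refine lintegral_congr fun ξ => ?_
    simp only [map_neg, map_smul, LinearMap.neg_apply, LinearMap.smul_apply]
    congr 2
    abel
  simp_rw [h1]
  rw [lintegral_add_right _ measurable_const,
    lintegral_enorm_add_sq_multivariateGaussian hR c (-G)]
  have h4 : (-G * R * (-G)ᵀ).trace = (G * R * Gᵀ).trace := by simp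
  have h5 : 0 ≤ (G * R * Gᵀ).trace := (hR.mul_mul_conjTranspose_same G).trace_nonneg
  rw [h4, lintegral_const, measure_univ, mul_one, ← ENNReal.ofReal_add (by positivity) h0]
  congr 1
  ring

/-- The Bayes risk for a Gaussian prior `N(0, R)` is at least the risk of a linear estimate. -/
lemma exists_linear_bayes_lower_bound {R : Matrix (Fin d) (Fin d) ℝ} (hR : R.PosSemidef)
    (A : Matrix (Fin m) (Fin d) ℝ) (B : Matrix (Fin ν) (Fin d) ℝ) {σ : ℝ} (hσ : 0 < σ) :
    ∃ H : Matrix (Fin m) (Fin ν) ℝ,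
      ∀ w : EuclideanSpace ℝ (Fin m) → EuclideanSpace ℝ (Fin ν), Measurable w →
        ENNReal.ofReal (σ ^ 2 * (Hᵀ * H).trace + ((B - Hᵀ * A) * R * (B - Hᵀ * A)ᵀ).trace) ≤
        ∫⁻ y, ∫⁻ ξ, ‖w (A.toEuclideanLin y + σ • ξ) - B.toEuclideanLin y‖ₑ ^ 2
          ∂(stdGaussian (EuclideanSpace ℝ (Fin m))) ∂(multivariateGaussian 0 R) := by
  obtain ⟨H, hH⟩ := exists_orthogonal_linear_estimate hR A B hσ
  refine ⟨H, fun w hw => ?_⟩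
  set G := B - Hᵀ * A with hG
  set μ := multivariateGaussian (0 : EuclideanSpace ℝ (Fin d)) R with hμ
  set γ := stdGaussian (EuclideanSpace ℝ (Fin m)) with hγ
  set LA := A.toEuclideanLin.toContinuousLinearMap with hLA
  set LG := G.toEuclideanLin.toContinuousLinearMap with hLG
  set LH := Hᵀ.toEuclideanLin.toContinuousLinearMap with hLH
  set X : EuclideanSpace ℝ (Fin d) × EuclideanSpace ℝ (Fin m) → EuclideanSpace ℝ (Fin m) :=
    fun p => LA p.1 + σ • p.2 with hX
  set Z : EuclideanSpace ℝ (Fin d) × EuclideanSpace ℝ (Fin m) → EuclideanSpace ℝ (Fin ν) :=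
    fun p => LG p.1 - σ • LH p.2 with hZ
  have hXm : Measurable X := by fun_prop
  have hZm : Measurable Z := by fun_prop
  have hgauss : HasGaussianLaw (fun p => (X p, Z p)) (μ.prod γ) :=
    (IsGaussian.hasGaussianLaw_id (μ := μ.prod γ)).map_fun
      ((LA.comp (.fst ℝ _ _) + σ • .snd ℝ _ _).prod
        (LG.comp (.fst ℝ _ _) - σ • LH.comp (.snd ℝ _ _)))
  -- `Z` is the residual `By - HᵀX` of the observation `X`. For jointly Gaussian vectors zero
  -- covariance means independence, and the choice of `H` makes the covariance vanish.
  have hind : IndepFun X Z (μ.prod γ) := by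
    refine hgauss.indepFun_of_covariance_inner fun x z => ?_
    have h1 : (fun p => ⟪x, X p⟫) = fun p : EuclideanSpace ℝ (Fin d) × EuclideanSpace ℝ (Fin m) =>
        ⟪Aᵀ.toEuclideanLin x, p.1⟫ + ⟪σ • x, p.2⟫ := by
      ext p
      rw [hX, inner_add_right, real_inner_smul_right, real_inner_smul_left]
      congr 1
      exact inner_toEuclideanLin A x p.1
    have h2 : (fun p => ⟪z, Z p⟫) = fun p : EuclideanSpace ℝ (Fin d) × EuclideanSpace ℝ (Fin m) =>
        ⟪Gᵀ.toEuclideanLin z, p.1⟫ + ⟪(-σ) • H.toEuclideanLin z, p.2⟫ := by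
      ext p
      rw [hZ, inner_sub_right, real_inner_smul_right, real_inner_smul_left, sub_eq_add_neg, neg_mul]
      congr 1
      · exact inner_toEuclideanLin G z p.1
      · congr 2
        exact inner_toEuclideanLin Hᵀ z p.2
    rw [h1, h2, covariance_prod_inner, covarianceBilin_multivariateGaussian hR, hγ,
      covarianceBilin_stdGaussian, innerSL_apply_apply, real_inner_smul_left,
      real_inner_smul_right, ← WithLp.toLp_ofLp 2 x, inner_toLp_eq_dotProduct]
    have h3 : (Aᵀ *ᵥ x.ofLp) ⬝ᵥ (R *ᵥ (Gᵀ *ᵥ z.ofLp)) = σ ^ 2 * (x.ofLp ⬝ᵥ (H *ᵥ z.ofLp)) := by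
      rw [mulVec_transpose, ← dotProduct_mulVec, mulVec_mulVec, mulVec_mulVec, hH, smul_mulVec,
        dotProduct_smul, smul_eq_mul]
    refine Eq.trans (congrArg₂ (· + ·) h3 rfl) ?_
    simp only [toLpLin_apply]
    ring
  have hfm : Measurable fun q : EuclideanSpace ℝ (Fin m) × EuclideanSpace ℝ (Fin ν) =>
      ‖(w q.1 - LH q.1) - q.2‖ₑ ^ 2 := by fun_prop
  have hmap := (indepFun_iff_map_prod_eq_prod_map_map hXm.aemeasurable hZm.aemeasurable).1 hind
  have : IsProbabilityMeasure ((μ.prod γ).map X) :=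
    Measure.isProbabilityMeasure_map hXm.aemeasurable
  have : IsProbabilityMeasure ((μ.prod γ).map Z) :=
    Measure.isProbabilityMeasure_map hZm.aemeasurable
  -- By independence `w(X) - HᵀX` can be frozen at a constant `c`; as `Z` is centered, `c` can only
  -- increase the mean square.
  have hinner : ∀ c : EuclideanSpace ℝ (Fin ν),
      ENNReal.ofReal (σ ^ 2 * (Hᵀ * H).trace + (G * R * Gᵀ).trace) ≤
        ∫⁻ b, ‖c - b‖ₑ ^ 2 ∂((μ.prod γ).map Z) := by
    intro c
    rw [lintegral_map (by fun_prop) hZm, lintegral_prod _ (by fun_prop)]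
    refine le_trans ?_ (lintegral_enorm_sub_sq_prod hR G H σ c).ge
    exact ENNReal.ofReal_le_ofReal (le_add_of_nonneg_left (sq_nonneg _))
  calc _ = ∫⁻ _, ENNReal.ofReal (σ ^ 2 * (Hᵀ * H).trace + (G * R * Gᵀ).trace)
        ∂((μ.prod γ).map X) := by rw [lintegral_const, measure_univ, mul_one]
    _ ≤ ∫⁻ a, ∫⁻ b, ‖(w a - LH a) - b‖ₑ ^ 2 ∂((μ.prod γ).map Z) ∂((μ.prod γ).map X) :=
      lintegral_mono fun a => hinner _
    _ = ∫⁻ p, ‖(w (X p) - LH (X p)) - Z p‖ₑ ^ 2 ∂(μ.prod γ) := by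
      rw [← lintegral_prod _ hfm.aemeasurable, ← hmap, lintegral_map hfm (hXm.prodMk hZm)]
    _ = ∫⁻ p, ‖w (X p) - B.toEuclideanLin p.1‖ₑ ^ 2 ∂(μ.prod γ) := by
      refine lintegral_congr fun p => ?_
      have h1 : LH (X p) + Z p = B.toEuclideanLin p.1 := by
        have h2 : G.toEuclideanLin p.1 =
            B.toEuclideanLin p.1 - Hᵀ.toEuclideanLin (A.toEuclideanLin p.1) := by
          rw [hG, map_sub, LinearMap.sub_apply, toEuclideanLin_mul_apply]
        change Hᵀ.toEuclideanLin (A.toEuclideanLin p.1 + σ • p.2) +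
          (G.toEuclideanLin p.1 - σ • Hᵀ.toEuclideanLin p.2) = _
        rw [h2, map_add, map_smul]
        abel
      rw [sub_sub, h1]
    _ = _ := by
      refine lintegral_prod _ (Measurable.aemeasurable ?_)
      have : Measurable fun p : EuclideanSpace ℝ (Fin d) × EuclideanSpace ℝ (Fin m) =>
          B.toEuclideanLin p.1 :=
        B.toEuclideanLin.toContinuousLinearMap.measurable.comp measurable_fst
      exact (((hw.comp hXm).sub this).enorm).pow_const 2

end Bayes

/-! ### Radial truncation -/

section Truncation

open scoped RealInnerProductSpace

variable {F : Type*} [NormedAddCommGroup F] [InnerProductSpace ℝ F]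

/-- Radial projection onto the ball of radius `M` around the origin. -/
noncomputable def radialTruncation (M : ℝ) (v : F) : F := min 1 (M / ‖v‖) • v

lemma norm_radialTruncation_le {M : ℝ} (hM : 0 ≤ M) (v : F) : ‖radialTruncation M v‖ ≤ M := by
  rcases eq_or_ne v 0 with rfl | hv
  · simpa [radialTruncation] using hM
  · have hv' : 0 < ‖v‖ := norm_pos_iff.2 hv
    rw [radialTruncation, norm_smul, Real.norm_of_nonneg (by positivity)]
    calc _ ≤ M / ‖v‖ * ‖v‖ := mul_le_mul_of_nonneg_right (min_le_right _ _) hv'.le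
      _ = M := div_mul_cancel₀ _ hv'.ne'

/-- Projection onto a ball does not move a point away from any point of the ball. -/
lemma norm_radialTruncation_sub_le {M : ℝ} (v : F) {b : F} (hb : ‖b‖ ≤ M) :
    ‖radialTruncation M v - b‖ ≤ ‖v - b‖ := by
  rcases le_or_gt ‖v‖ M with hv | hv
  · rcases eq_or_ne v 0 with rfl | h0
    · simp [radialTruncation]
    · rw [radialTruncation, min_eq_left ((one_le_div (norm_pos_iff.2 h0)).2 hv), one_smul]
  · have hM : 0 ≤ M := (norm_nonneg b).trans hb
    have hv' : 0 < ‖v‖ := hM.trans_lt hv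
    rw [radialTruncation, min_eq_right ((div_le_one hv').2 hv.le)]
    set c := M / ‖v‖ with hc
    have hcv : c * ‖v‖ = M := div_mul_cancel₀ _ hv'.ne'
    have hc1 : c ≤ 1 := (div_le_one hv').2 hv.le
    have hc0 : 0 ≤ c := by positivity
    refine le_of_sq_le_sq ?_ (norm_nonneg _)
    rw [norm_sub_sq_real, norm_sub_sq_real, norm_smul, real_inner_smul_left,
      Real.norm_of_nonneg hc0]
    have h1 : ⟪v, b⟫ ≤ ‖v‖ * M :=
      (real_inner_le_norm v b).trans (mul_le_mul_of_nonneg_left hb hv'.le)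
    have h2 := mul_le_mul_of_nonneg_left h1 (sub_nonneg.2 hc1)
    have h3 := mul_nonneg (mul_nonneg (sub_nonneg.2 hc1) hv'.le) (sub_nonneg.2 hv.le)
    rw [← hcv] at h2 h3
    nlinarith

lemma measurable_radialTruncation [MeasurableSpace F] [BorelSpace F] [SecondCountableTopology F]
    (M : ℝ) : Measurable (radialTruncation M : F → F) := by
  unfold radialTruncation
  fun_prop

end Truncation

/-! ### Comparison of `Opt` with the minimax risk -/

section Risk

variable {m n nbar K ν : ℕ} (E : Ellitope n nbar K) (A : Matrix (Fin m) (Fin n) ℝ)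
    (B : Matrix (Fin ν) (Fin n) ℝ) (σ : ℝ)

lemma rpow_half_le_iff {a b : ℝ≥0∞} : a ^ (1 / 2 : ℝ) ≤ b ↔ a ≤ b ^ 2 := by
  rw [one_div, ENNReal.rpow_inv_le_iff (by norm_num)]
  simp

lemma norm_sq_toEuclideanLin {ι κ : Type*} [Fintype ι] [DecidableEq ι] [Fintype κ]
    (G : Matrix κ ι ℝ) (y : EuclideanSpace ℝ ι) :
    ‖G.toEuclideanLin y‖ ^ 2 = (G *ᵥ y.ofLp) ⬝ᵥ (G *ᵥ y.ofLp) := by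
  rw [EuclideanSpace.real_norm_sq_eq]
  simp [dotProduct, toLpLin_apply, sq]

lemma lintegral_le_risk_sq {X : Set (EuclideanSpace ℝ (Fin n))}
    (w : EuclideanSpace ℝ (Fin m) → EuclideanSpace ℝ (Fin ν)) {x : EuclideanSpace ℝ (Fin n)}
    (hx : x ∈ X) :
    ∫⁻ ξ, ‖w (A.toEuclideanLin x + σ • ξ) - B.toEuclideanLin x‖ₑ ^ 2
      ∂(stdGaussian (EuclideanSpace ℝ (Fin m))) ≤ risk A B σ X w ^ 2 :=
  rpow_half_le_iff.1 (le_iSup₂ (f := fun x (_ : x ∈ X) =>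
    (∫⁻ ξ, ‖w (A.toEuclideanLin x + σ • ξ) - B.toEuclideanLin x‖ₑ ^ 2
      ∂(stdGaussian (EuclideanSpace ℝ (Fin m)))) ^ (1 / 2 : ℝ)) x hx)

lemma Mstar_nonneg : 0 ≤ Mstar E B := Real.sqrt_nonneg _

/-- The rank-one matrix `yyᵀ` belongs to `Qset`. Hence truncating an estimate at `M_*` cannot hurt
on the signal set. -/
lemma norm_toEuclideanLin_le_Mstar {y : EuclideanSpace ℝ (Fin nbar)} {t : Fin K → ℝ}
    (ht : t ∈ E.T) (hy : ∀ k, y.ofLp ⬝ᵥ (E.S k *ᵥ y.ofLp) ≤ t k) :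
    ‖(B * E.P).toEuclideanLin y‖ ≤ Mstar E B := by
  refine le_of_sq_le_sq ?_ (Mstar_nonneg E B)
  refine (isGreatest_traceValues E B).2 ⟨vecMulVec y.ofLp y.ofLp, ⟨?_, t, ht, fun k => ?_⟩, ?_⟩
  · simpa using posSemidef_vecMulVec_self_star y.ofLp
  · rw [trace_mul_comm, trace_mul_vecMulVec_self]
    exact hy k
  · simp only
    rw [norm_sq_toEuclideanLin, trace_mul_comm, ← Matrix.mul_assoc, trace_mul_vecMulVec_self,
      dotProduct_transpose_mul_self_mulVec]

/-- The risk of a feasible linear estimate is at most the square root of its objective. -/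
lemma risk_linearEstimate_le {H : Matrix (Fin m) (Fin ν) ℝ} {lam : Fin K → ℝ}
    (h : (H, lam) ∈ programFeasible E A B) :
    risk A B σ E.X (linearEstimate H) ≤ ENNReal.ofReal √(programObjective E σ (H, lam)) := by
  refine iSup₂_le fun x hx => ?_
  obtain ⟨y, t, ht, rfl, hy⟩ := hx
  rw [rpow_half_le_iff, ← ENNReal.ofReal_pow (Real.sqrt_nonneg _),
    Real.sq_sqrt (programObjective_nonneg E A B σ h)]
  have h1 : ∀ ξ : EuclideanSpace ℝ (Fin m),
      linearEstimate H (A.toEuclideanLin (E.P.toEuclideanLin y) + σ • ξ) -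
        B.toEuclideanLin (E.P.toEuclideanLin y) =
      -(biasMatrix E A B H).toEuclideanLin y + (σ • Hᵀ).toEuclideanLin ξ := by
    intro ξ
    simp only [linearEstimate, biasMatrix, map_add, map_sub, map_smul, LinearMap.sub_apply,
      LinearMap.smul_apply, toEuclideanLin_mul_apply]
    abel
  simp_rw [h1]
  rw [lintegral_enorm_add_sq_stdGaussian]
  refine ENNReal.ofReal_le_ofReal ?_
  rw [norm_neg, norm_sq_toEuclideanLin, transpose_smul, transpose_transpose, Matrix.smul_mul,
    Matrix.mul_smul, smul_smul, trace_smul, smul_eq_mul, ← sq, add_comm, programObjective]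
  refine add_le_add le_rfl ?_
  have hf := (mem_programFeasible_iff E A B).1 h
  refine (hf.2 y.ofLp).trans (le_trans ?_ (E.dotProduct_le_supportFun lam ht))
  rw [sum_mulVec, dotProduct_sum]
  refine Finset.sum_le_sum fun k _ => ?_
  rw [smul_mulVec, dotProduct_smul, smul_eq_mul]
  exact mul_le_mul_of_nonneg_left (hy k) (hf.1 k)

/-- Take `H = 0` in the dual bound. -/
lemma programOpt_le_Mstar_sq (hσ : 0 < σ) : programOpt E A B σ ≤ Mstar E B ^ 2 := by
  refine le_of_forall_pos_le_add fun ε hε => ?_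
  obtain ⟨Q, hQ, h⟩ := exists_dual_matrix E A B σ hσ hε
  have h1 := h 0
  have h2 := (isGreatest_traceValues E B).2 ⟨Q, hQ, rfl⟩
  simp only [biasMatrix, transpose_zero, Matrix.zero_mul, trace_zero, mul_zero, sub_zero,
    zero_add] at h1
  rw [Matrix.mul_assoc, trace_mul_comm] at h1
  linarith

lemma Mstar_pos (hσ : 0 < σ) (hBP : B * E.P ≠ 0) : 0 < Mstar E B := by
  -- `M_*` does not involve `A`, so a trivial observation with no rows suffices.
  have h := (programOpt_pos E (0 : Matrix (Fin 0) (Fin n) ℝ) B σ hσ hBP).trans_le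
    (programOpt_le_Mstar_sq E _ B σ hσ)
  exact lt_of_le_of_ne (Mstar_nonneg E B) fun h0 => by simp [← h0] at h

/-- Pointwise bound of the error of the truncated estimate by its risk on the signal set and an
exponential penalty off this set. -/
lemma lintegral_truncated_le {M α : ℝ} (hM : M = Mstar E B) (hM0 : 0 < M) (hα : 0 < α)
    {t : Fin K → ℝ} (ht : t ∈ E.T) (htpos : ∀ k, 0 < t k)
    (w : EuclideanSpace ℝ (Fin m) → EuclideanSpace ℝ (Fin ν)) (y : EuclideanSpace ℝ (Fin nbar)) :
    ∫⁻ ξ, ‖radialTruncation M (w ((A * E.P).toEuclideanLin y + σ • ξ)) -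
        (B * E.P).toEuclideanLin y‖ₑ ^ 2 ∂(stdGaussian (EuclideanSpace ℝ (Fin m))) ≤
      risk A B σ E.X w ^ 2 + ∑ k, ENNReal.ofReal (2 * M ^ 2 * Real.exp (-(1 / (4 * α)))) *
        ENNReal.ofReal (Real.exp (y.ofLp ⬝ᵥ (((M ^ 2)⁻¹ • ((B * E.P)ᵀ * (B * E.P)) +
          (1 / (4 * α * t k)) • E.S k) *ᵥ y.ofLp))) := by
  by_cases hy : ∀ k, y.ofLp ⬝ᵥ (E.S k *ᵥ y.ofLp) ≤ t k
  · refine le_trans ?_ le_self_add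
    have hx : E.P.toEuclideanLin y ∈ E.X := ⟨y, t, ht, rfl, hy⟩
    refine le_trans (lintegral_mono fun ξ => ?_) (lintegral_le_risk_sq A B σ w hx)
    have hb := norm_toEuclideanLin_le_Mstar E B ht hy
    rw [← hM] at hb
    have := norm_radialTruncation_sub_le (w ((A * E.P).toEuclideanLin y + σ • ξ)) hb
    simp only [toEuclideanLin_mul_apply] at this ⊢
    rw [enorm_sq_eq_ofReal_norm_sq, enorm_sq_eq_ofReal_norm_sq]
    exact ENNReal.ofReal_le_ofReal (pow_le_pow_left₀ (norm_nonneg _) this 2)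
  · push Not at hy
    obtain ⟨k, hk⟩ := hy
    refine le_trans ?_ le_add_self
    refine le_trans ?_ (Finset.single_le_sum (f := fun k =>
      ENNReal.ofReal (2 * M ^ 2 * Real.exp (-(1 / (4 * α)))) *
        ENNReal.ofReal (Real.exp (y.ofLp ⬝ᵥ (((M ^ 2)⁻¹ • ((B * E.P)ᵀ * (B * E.P)) +
          (1 / (4 * α * t k)) • E.S k) *ᵥ y.ofLp)))) (fun _ _ => zero_le) (Finset.mem_univ k))
    set b := ‖(B * E.P).toEuclideanLin y‖ with hb
    have h1 : y.ofLp ⬝ᵥ (((M ^ 2)⁻¹ • ((B * E.P)ᵀ * (B * E.P)) +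
          (1 / (4 * α * t k)) • E.S k) *ᵥ y.ofLp) =
        (M ^ 2)⁻¹ * b ^ 2 + 1 / (4 * α * t k) * (y.ofLp ⬝ᵥ (E.S k *ᵥ y.ofLp)) := by
      rw [add_mulVec, smul_mulVec, smul_mulVec, dotProduct_add, dotProduct_smul, dotProduct_smul,
        dotProduct_transpose_mul_self_mulVec, hb, norm_sq_toEuclideanLin, smul_eq_mul, smul_eq_mul]
    -- A violated constraint contributes at least `1/(4α)` to the exponent, compensating the factor
    -- `exp(-1/(4α))`.
    have h2 : 1 / (4 * α) ≤ 1 / (4 * α * t k) * (y.ofLp ⬝ᵥ (E.S k *ᵥ y.ofLp)) := by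
      have := htpos k
      rw [div_mul_eq_mul_div, one_mul, div_le_div_iff₀ (by positivity) (by positivity)]
      nlinarith [mul_pos hα this]
    have h3 : ∀ ξ : EuclideanSpace ℝ (Fin m),
        ‖radialTruncation M (w ((A * E.P).toEuclideanLin y + σ • ξ)) -
          (B * E.P).toEuclideanLin y‖ₑ ^ 2 ≤
        ENNReal.ofReal (2 * M ^ 2 * Real.exp (-(1 / (4 * α)))) *
        ENNReal.ofReal (Real.exp (y.ofLp ⬝ᵥ (((M ^ 2)⁻¹ • ((B * E.P)ᵀ * (B * E.P)) +
          (1 / (4 * α * t k)) • E.S k) *ᵥ y.ofLp))) := by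
      intro ξ
      rw [← ENNReal.ofReal_mul (by positivity), enorm_sq_eq_ofReal_norm_sq, mul_assoc,
        ← Real.exp_add, h1]
      refine ENNReal.ofReal_le_ofReal ?_
      have h4 := norm_sub_le (radialTruncation M (w ((A * E.P).toEuclideanLin y + σ • ξ)))
        ((B * E.P).toEuclideanLin y)
      have h5 := norm_radialTruncation_le hM0.le (w ((A * E.P).toEuclideanLin y + σ • ξ))
      have h6 : ‖radialTruncation M (w ((A * E.P).toEuclideanLin y + σ • ξ)) -
          (B * E.P).toEuclideanLin y‖ ^ 2 ≤ (M + b) ^ 2 :=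
        pow_le_pow_left₀ (norm_nonneg _) (h4.trans (by linarith)) 2
      -- With `1 + s ≤ exp s` at `s = b²/M²`, this absorbs `(M + b)² ≤ 2M²(1 + b²/M²)`.
      have h7 : (M ^ 2)⁻¹ * b ^ 2 + 1 ≤ Real.exp (-(1 / (4 * α)) + ((M ^ 2)⁻¹ * b ^ 2 +
          1 / (4 * α * t k) * (y.ofLp ⬝ᵥ (E.S k *ᵥ y.ofLp)))) :=
        (Real.add_one_le_exp _).trans (Real.exp_le_exp.2 (by linarith))
      have h8 : 2 * M ^ 2 * ((M ^ 2)⁻¹ * b ^ 2 + 1) = 2 * b ^ 2 + 2 * M ^ 2 := by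
        field_simp
      have h9 := mul_le_mul_of_nonneg_left h7 (by positivity : 0 ≤ 2 * M ^ 2)
      nlinarith [sq_nonneg (M - b)]
    calc _ ≤ ∫⁻ _, _ ∂(stdGaussian (EuclideanSpace ℝ (Fin m))) := lintegral_mono h3
      _ = _ := by rw [lintegral_const, measure_univ, mul_one]

/-- Comparison of the optimal value with the risk of an arbitrary estimate. -/
lemma ofReal_mul_programOpt_le_risk_sq_add (hσ : 0 < σ) (hM0 : 0 < Mstar E B) {α : ℝ}
    (hα : 0 < α) (hα8 : α ≤ 1 / 8)
    {w : EuclideanSpace ℝ (Fin m) → EuclideanSpace ℝ (Fin ν)} (hw : Measurable w) :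
    ENNReal.ofReal (α * programOpt E A B σ) ≤ risk A B σ E.X w ^ 2 +
      ENNReal.ofReal (4 * Mstar E B ^ 2 * K * Real.exp (-(1 / (4 * α)))) := by
  suffices hε : ∀ ε : ℝ, 0 < ε → ENNReal.ofReal (α * (programOpt E A B σ - ε)) ≤
      risk A B σ E.X w ^ 2 +
        ENNReal.ofReal (4 * Mstar E B ^ 2 * K * Real.exp (-(1 / (4 * α)))) by
    have hlim : Filter.Tendsto (fun ε : ℝ => ENNReal.ofReal (α * (programOpt E A B σ - ε)))
        (nhdsWithin 0 (Set.Ioi 0)) (nhds (ENNReal.ofReal (α * (programOpt E A B σ - 0)))) := by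
      refine Filter.Tendsto.mono_left (Continuous.tendsto ?_ 0) nhdsWithin_le_nhds
      exact ENNReal.continuous_ofReal.comp (by fun_prop)
    rw [sub_zero] at hlim
    exact le_of_tendsto hlim (eventually_mem_nhdsWithin.mono fun ε h => hε ε h)
  intro ε hε
  obtain ⟨Q, hQ, ⟨t, ht, htpos, htr⟩, hdual⟩ := exists_dual_matrix_pos E A B σ hσ hε
  set M := Mstar E B with hM
  have hR : (α • Q).PosSemidef := hQ.1.smul hα.le
  obtain ⟨H, hH⟩ := exists_linear_bayes_lower_bound hR (A * E.P) (B * E.P) hσ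
  have h1 := hH (fun ω => radialTruncation M (w ω)) ((measurable_radialTruncation M).comp hw)
  -- Scaling `Q` by `α ≤ 1` scales the bias term only; the noise term merely exceeds its `α`
  -- multiple.
  have h2 : α * (programOpt E A B σ - ε) ≤ σ ^ 2 * (Hᵀ * H).trace +
      ((B * E.P - Hᵀ * (A * E.P)) * (α • Q) * (B * E.P - Hᵀ * (A * E.P))ᵀ).trace := by
    have h0 : ((B * E.P - Hᵀ * (A * E.P)) * Q * (B * E.P - Hᵀ * (A * E.P))ᵀ).trace =
        ((B * E.P - Hᵀ * (A * E.P))ᵀ * (B * E.P - Hᵀ * (A * E.P)) * Q).trace := by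
      rw [trace_mul_comm, ← Matrix.mul_assoc]
    rw [Matrix.mul_smul, Matrix.smul_mul, trace_smul, smul_eq_mul, h0]
    have h3 := mul_le_mul_of_nonneg_left (hdual H) hα.le
    have h4 := mul_nonneg (sq_nonneg σ) (trace_transpose_mul_self_nonneg H)
    simp only [biasMatrix] at h3
    nlinarith
  refine (ENNReal.ofReal_le_ofReal h2).trans (h1.trans ?_)
  refine (lintegral_mono (lintegral_truncated_le E A B σ hM hM0 hα ht htpos w)).trans ?_
  have hmeas : ∀ W : Matrix (Fin nbar) (Fin nbar) ℝ, Measurable fun y :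
      EuclideanSpace ℝ (Fin nbar) => ENNReal.ofReal (Real.exp (y.ofLp ⬝ᵥ (W *ᵥ y.ofLp))) := by
    intro W
    refine ENNReal.measurable_ofReal.comp (Continuous.measurable ?_)
    fun_prop
  rw [lintegral_add_left measurable_const, lintegral_const, measure_univ, mul_one]
  refine add_le_add le_rfl ?_
  rw [lintegral_finsetSum _ (fun k _ => (hmeas _).const_mul _)]
  calc _ ≤ ∑ _k : Fin K, ENNReal.ofReal (2 * M ^ 2 * Real.exp (-(1 / (4 * α)))) * 2 := by
        refine Finset.sum_le_sum fun k _ => ?_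
        rw [lintegral_const_mul _ (hmeas _)]
        refine mul_le_mul_right (lintegral_exp_quadForm_le hR ?_ ?_) _
        · have := htpos k
          exact ((posSemidef_conjTranspose_mul_self (B * E.P)).smul (by positivity)).add
            ((E.S_posSemidef k).smul (by positivity))
        -- The two parts of the trace are at most `α` and `1/4`; `α ≤ 1/8` brings the total to
        -- `3/8`.
        · have h5 : ((B * E.P) * Q * (B * E.P)ᵀ).trace ≤ M ^ 2 :=
            (isGreatest_traceValues E B).2 ⟨Q, hQ, rfl⟩
          rw [Matrix.mul_assoc, trace_mul_comm, Matrix.mul_assoc] at h5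
          have h6 := htr k
          have h7 := htpos k
          rw [Matrix.smul_mul, trace_smul, Matrix.mul_add, trace_add, Matrix.mul_smul,
            Matrix.mul_smul, trace_smul, trace_smul]
          simp only [smul_eq_mul]
          have h8 : (M ^ 2)⁻¹ * (Q * ((B * E.P)ᵀ * (B * E.P))).trace ≤ 1 := by
            rw [inv_mul_le_iff₀ (by positivity), mul_one]
            exact h5
          have h9 : α * (1 / (4 * α * t k) * (Q * E.S k).trace) ≤ 1 / 4 := by
            have : α * (1 / (4 * α * t k) * (Q * E.S k).trace) = (Q * E.S k).trace / (4 * t k) := by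
              field_simp
            rw [this, div_le_div_iff₀ (by positivity) (by norm_num)]
            linarith
          nlinarith [mul_le_mul_of_nonneg_left h8 hα.le]
    _ = _ := by
        rw [Finset.sum_const, Finset.card_univ, Fintype.card_fin, nsmul_eq_mul,
          ← ENNReal.ofReal_natCast, ← ENNReal.ofReal_ofNat 2, ← ENNReal.ofReal_mul (by positivity),
          ← ENNReal.ofReal_mul (by positivity)]
        congr 1
        ring

lemma ofReal_mul_programOpt_le_riskOpt_sq_add (hσ : 0 < σ) (hM0 : 0 < Mstar E B) {α : ℝ}
    (hα : 0 < α) (hα8 : α ≤ 1 / 8) :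
    ENNReal.ofReal (α * programOpt E A B σ) ≤ riskOpt A B σ E.X ^ 2 +
      ENNReal.ofReal (4 * Mstar E B ^ 2 * K * Real.exp (-(1 / (4 * α)))) := by
  rw [← tsub_le_iff_right, ← rpow_half_le_iff]
  refine le_iInf₂ fun w hw => ?_
  rw [rpow_half_le_iff, tsub_le_iff_right]
  exact ofReal_mul_programOpt_le_risk_sq_add E A B σ hσ hM0 hα hα8 hw

lemma riskOpt_le_programOpt (hσ : 0 < σ) :
    riskOpt A B σ E.X ≤ ENNReal.ofReal √(programOpt E A B σ) := by
  obtain ⟨⟨H, l⟩, hp⟩ := exists_isOptimalSolution E A B σ hσ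
  have hmeas : Measurable (linearEstimate H) :=
    Hᵀ.toEuclideanLin.toContinuousLinearMap.measurable
  refine (iInf₂_le _ hmeas).trans ?_
  rw [← hp.programObjective_eq]
  exact risk_linearEstimate_le E A B σ hp.1

/-- For `K = 0` the sum of the `S_k` is the zero matrix, which is not positive definite in positive
dimension. -/
lemma Ellitope.one_le_K (E : Ellitope n nbar K) [Nonempty (Fin nbar)] : (1 : ℝ) ≤ K := by
  rcases Nat.eq_zero_or_pos K with rfl | hK
  · have h := E.sum_S_posDef.diag_pos (i := Classical.arbitrary _)
    simp at h
  · exact_mod_cast hK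

end Risk

/-! ### Choice of `α` and conclusion -/

theorem theorem1 {m n nbar K ν : ℕ} (E : Ellitope n nbar K)
    (A : Matrix (Fin m) (Fin n) ℝ) (B : Matrix (Fin ν) (Fin n) ℝ) (σ : ℝ)
    (hσ : 0 < σ) (hBP : B * E.P ≠ 0) :
    -- the design program is convex and solvable, and `M_*²` is a maximum
    ConvexOn ℝ (programFeasible E A B) (programObjective E σ) ∧
    (∃ p, IsOptimalSolution E A B σ p) ∧
    IsGreatest (traceValues E B) (Mstar E B ^ 2) ∧
    -- the minimax risk is a positive real number
    0 < riskOpt A B σ E.X ∧ riskOpt A B σ E.X < ∞ ∧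
    -- the risk of every optimal linear estimate is at most `√Opt`
    (∀ H lam, IsOptimalSolution E A B σ (H, lam) →
      risk A B σ E.X (linearEstimate H) ≤ ENNReal.ofReal √(programOpt E A B σ)) ∧
    -- near-optimality
    √(programOpt E A B σ) ≤
      √(6 * Real.log (8 * Mstar E B ^ 2 * K / (riskOpt A B σ E.X).toReal ^ 2)) *
        (riskOpt A B σ E.X).toReal := by
  have hM0 := Mstar_pos E B σ hσ hBP
  have hOpt0 := programOpt_pos E A B σ hσ hBP
  have hOptM := programOpt_le_Mstar_sq E A B σ hσ
  have hle := riskOpt_le_programOpt E A B σ hσ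
  have hfin : riskOpt A B σ E.X < ∞ := hle.trans_lt ENNReal.ofReal_lt_top
  have hK : (1 : ℝ) ≤ K := by
    have : Nonempty (Fin nbar) := by
      by_contra h
      rw [not_nonempty_iff] at h
      exact hBP (Matrix.ext fun _ j => isEmptyElim j)
    exact E.one_le_K
  set M := Mstar E B with hM
  set O := programOpt E A B σ with hO
  set r := (riskOpt A B σ E.X).toReal with hr
  have hr0 : 0 ≤ r := ENNReal.toReal_nonneg
  have hkey : ∀ α : ℝ, 0 < α → α ≤ 1 / 8 →
      α * O ≤ r ^ 2 + 4 * M ^ 2 * K * Real.exp (-(1 / (4 * α))) := by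
    intro α hα hα8
    have h := ofReal_mul_programOpt_le_riskOpt_sq_add E A B σ hσ hM0 hα hα8
    rw [← ENNReal.ofReal_toReal hfin.ne, ← ENNReal.ofReal_pow ENNReal.toReal_nonneg,
      ← ENNReal.ofReal_add (by positivity) (by positivity)] at h
    exact (ENNReal.ofReal_le_ofReal_iff (by positivity)).1 h
  have hrpos : 0 < r := by
    refine lt_of_le_of_ne hr0 fun h0 => ?_
    set c := 32 * M ^ 2 * K with hc
    have hc0 : 0 < c := by positivity
    -- If the risk vanished, `α = 1/(4x)` and `exp x ≥ x²/2` would give `O x ≤ c`, whereas `O x = 2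
    -- O + c`. The summand 2 keeps `α ≤ 1/8`.
    set x := 2 + c / O with hx
    have hx0 : 0 < x := by positivity
    have h1 := hkey (1 / (4 * x)) (by positivity) (by
      rw [div_le_div_iff₀ (by positivity) (by norm_num)]
      have : 2 ≤ x := by rw [hx]; linarith [div_pos hc0 hOpt0]
      linarith)
    have h2 : 1 / (4 * (1 / (4 * x))) = x := by field_simp
    rw [h2, ← h0, Real.exp_neg] at h1
    have h3 : x ^ 2 / 2 ≤ Real.exp x := by
      linarith [Real.quadratic_le_exp_of_nonneg hx0.le]
    have h4 : (Real.exp x)⁻¹ ≤ (x ^ 2 / 2)⁻¹ := inv_anti₀ (by positivity) h3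
    have h5 : 1 / (4 * x) * O ≤ 4 * M ^ 2 * K * (x ^ 2 / 2)⁻¹ := by
      have := mul_le_mul_of_nonneg_left h4 (by positivity : 0 ≤ 4 * M ^ 2 * K)
      linarith
    have h6 : 4 * M ^ 2 * K * (x ^ 2 / 2)⁻¹ = (c / x) * (1 / (4 * x)) := by
      rw [hc]; field_simp; norm_num
    rw [h6, mul_comm (c / x)] at h5
    have h7 := le_of_mul_le_mul_left h5 (by positivity : 0 < 1 / (4 * x))
    rw [le_div_iff₀ hx0, hx, mul_add, mul_div_cancel₀ _ hOpt0.ne'] at h7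
    linarith
  have hrM : r ^ 2 ≤ M ^ 2 := by
    have h1 : r ≤ √O := by
      have := ENNReal.toReal_mono ENNReal.ofReal_ne_top hle
      rwa [ENNReal.toReal_ofReal (Real.sqrt_nonneg _)] at this
    calc r ^ 2 ≤ √O ^ 2 := pow_le_pow_left₀ hr0 h1 2
      _ = O := Real.sq_sqrt hOpt0.le
      _ ≤ M ^ 2 := hOptM
  refine ⟨convexOn_programObjective E A B σ, exists_isOptimalSolution E A B σ hσ,
    isGreatest_traceValues E B, (ENNReal.toReal_pos_iff.1 hrpos).1, hfin, fun H lam h => ?_, ?_⟩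
  · rw [hO, ← h.programObjective_eq]
    exact risk_linearEstimate_le E A B σ h.1
  · set L := Real.log (8 * M ^ 2 * K / r ^ 2) with hL
    have harg : 8 ≤ 8 * M ^ 2 * K / r ^ 2 := by
      rw [le_div_iff₀ (by positivity)]
      nlinarith [mul_le_mul_of_nonneg_left hK (sq_nonneg M)]
    -- `exp 2 < 8`, so `α = 1/(4L)` is at most `1/8`.
    have hL2 : 2 ≤ L := by
      rw [hL, Real.le_log_iff_exp_le (by linarith)]
      refine le_trans ?_ harg
      have h1 : Real.exp 2 = Real.exp 1 ^ 2 := by rw [← Real.exp_nat_mul]; norm_num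
      rw [h1]
      nlinarith [Real.exp_one_lt_d9, Real.exp_pos 1]
    have h1 := hkey (1 / (4 * L)) (by positivity) (by
      rw [div_le_div_iff₀ (by positivity) (by norm_num)]; linarith)
    have h2 : 1 / (4 * (1 / (4 * L))) = L := by field_simp
    rw [h2, Real.exp_neg, hL, Real.exp_log (by linarith), ← hL] at h1
    -- The penalty equals `r²/2`, so `O/(4L) ≤ 3r²/2`: this is the source of the constant 6.
    have h3 : 4 * M ^ 2 * K * (8 * M ^ 2 * K / r ^ 2)⁻¹ = r ^ 2 / 2 := by
      field_simp; norm_num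
    rw [h3, div_mul_eq_mul_div, one_mul, div_le_iff₀ (by positivity)] at h1
    rw [Real.sqrt_le_left (by positivity), mul_pow, Real.sq_sqrt (by positivity)]
    linarith
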